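/- **Setting.** A standard graded Artinian algebra $A=\bigoplus_{j\ge 0}[A]_j$ over a field has the weak Lefschetz property (WLP) if there is a linear form $\ell$ such that, for every $j$, the multiplication map $\ell:[A]_{j}\to[A]_{j+1}$ has maximal rank, i.e. is injective or surjective. For integers $n$ and $d$, let $\mathcal C(n,d)$ denote the following assertion (for even $n\ge 8$ and all $d$, this is the conjecture of Migliore, Miró-Roig and Nagel): for every field $K$ of characteristic zero and a general linear form $L\in R=K[x_0,\dots,x_n]$, the ring $R/(x_0^d,\dots,x_n^d,L^d)$ fails the WLP if and only if $d>1$. Here "general" means that the coefficient vector of $L$ lies outside the zero locus of some nonzero polynomial, which may depend on $K,n,d$. For $0\le j<i$ let $A(i,j)$ be the Eulerian number, i.e. the number of permutations of $i$ elements with exactly $j$ ascents. In all parts $d$ ranges over nonnegative integers. For integers $m\ge 2$ and $q$ with $0\le q\le 2m$ define a polynomial function $P_{m,q}:\mathbb R\to\mathbb R$ by $$P_{m,q}(t)=\sum_{k=0}^{m}(-1)^k\binom{2m+2}{k}\binom{m-1+\lfloor\frac{mq}{2m+1}\rfloor+(q+1)(m-k)+t\,[2m(m+1)-k(2m+1)]}{2m-1},$$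 where $\binom{x}{2m-1}=\frac{x(x-1)\cdots(x-2m+2)}{(2m-1)!}$. **Proposition.** Let $m\ge 2$ be an integer and $n=2m$. (a) If $0\le q\le 2m$ and $P_{m,q}$ is not identical to a positive constant, then $\mathcal C(n,d)$ is true for every $d\gg 0$ such that $n+1$ divides $d-1-q$. (b) If $1\le q\le 2m$ and $P_{m,q}(t)\le 0$ for every integer $t\ge 0$, then $\mathcal C(n,d)$ is true for every $d\ge n^2-n+2$ such that $n+1$ divides $d-1-q$. (c) If $P_{m,0}(t)\le 0$ for every integer $t\ge 1$, then $\mathcal C(n,d)$ is true for every $d$ such that $n+1$ divides $d-1$. (d) If $\sum_{k=0}^{m}(-1)^k\binom{2m+2}{k}\,[2m(m+1)-k(2m+1)]^{2m-1}\neq 0$, then $\mathcal C(n,d)$ is true for every $d\gg 0$. (e) If $m\ge 5$ and $A(2m-1,m-1)-2A(2m-1,m-2)+A(2m-1,m-3)<0$, then $\mathcal C(n,d)$ is true for every $d\gg 0$. -/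

import Mathlib

universe u

noncomputable section

namespace UniformPowers

/-- The degree `j` component `[A]_j` of `A = K[x_i : i ∈ σ]/I` with respect to the grading inherited
from the polynomial ring: the image of the space of forms of degree `j`. -/
def gradedPiece {σ K : Type*} [Field K] (I : Ideal (MvPolynomial σ K)) (j : ℕ) :
    Submodule K (MvPolynomial σ K ⧸ I) :=
  (MvPolynomial.homogeneousSubmodule σ K j).map (Ideal.Quotient.mkₐ K I).toLinearMap

/-- The weak Lefschetz property of `A = K[x_i : i ∈ σ]/I`, for `σ` finite and `I` homogeneous with
Artinian quotient: there is a linear form `ℓ` such that, for every `j`, the multiplication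
`ℓ : [A]_j → [A]_{j+1}` has maximal rank, that is, it is injective or surjective. -/
def HasWLP {σ K : Type*} [Field K] (I : Ideal (MvPolynomial σ K)) : Prop :=
  ∃ ℓ ∈ MvPolynomial.homogeneousSubmodule σ K 1, ∀ j : ℕ,
    Set.InjOn (fun x => Ideal.Quotient.mk I ℓ * x) (gradedPiece I j) ∨
    Set.SurjOn (fun x => Ideal.Quotient.mk I ℓ * x) (gradedPiece I j) (gradedPiece I (j + 1))

/-- The linear form `a₀ x₀ + ⋯ + aₙ xₙ`. -/
def linearForm {K : Type*} [Field K] {n : ℕ} (a : Fin (n + 1) → K) :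
    MvPolynomial (Fin (n + 1)) K :=
  ∑ i, MvPolynomial.C (a i) * MvPolynomial.X i

/-- The property `p` holds for a general linear form `L ∈ K[x₀, …, xₙ]`: it holds for all linear
forms whose coefficient vector lies outside the zero locus of some nonzero polynomial `F`. -/
def ForGeneralLinearForm (K : Type*) [Field K] (n : ℕ)
    (p : MvPolynomial (Fin (n + 1)) K → Prop) : Prop :=
  ∃ F : MvPolynomial (Fin (n + 1)) K, F ≠ 0 ∧
    ∀ a : Fin (n + 1) → K, MvPolynomial.eval a F ≠ 0 → p (linearForm a)

/-- The ideal `(x₀^d, …, xₙ^d, L^d)`. -/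
def powerIdeal {K : Type*} [Field K] {n : ℕ} (L : MvPolynomial (Fin (n + 1)) K) (d : ℕ) :
    Ideal (MvPolynomial (Fin (n + 1)) K) :=
  Ideal.span (Set.range (fun i => MvPolynomial.X i ^ d) ∪ {L ^ d})

/-- The assertion of the conjecture for a given pair `(n, d)`: over every field `K` of
characteristic zero, for a general linear form `L`, the ring
`K[x₀, …, xₙ]/(x₀^d, …, xₙ^d, L^d)` fails the weak Lefschetz property if and only if `d > 1`. -/
def FailureConjecture (n d : ℕ) : Prop :=
  ∀ (K : Type u) [Field K] [CharZero K],
    ForGeneralLinearForm K n (fun L => ¬ HasWLP (powerIdeal L d) ↔ 1 < d)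

/-- The polynomial function `P_{m,q} : ℝ → ℝ`. The binomial coefficient
`Ring.choose x k = x (x - 1) ⋯ (x - k + 1) / k!` is a polynomial in its upper entry `x`; the
division `m * q / (2 * m + 1)` of natural numbers is the floor of the quotient. -/
def P (m q : ℕ) (t : ℝ) : ℝ :=
  ∑ k ∈ Finset.range (m + 1), (-1) ^ k * ((2 * m + 2).choose k : ℝ) *
    Ring.choose ((m : ℝ) - 1 + ((m * q / (2 * m + 1) : ℕ) : ℝ) + (q + 1) * (m - k)
      + t * (2 * m * (m + 1) - k * (2 * m + 1))) (2 * m - 1)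

/-- The number of ascents of a permutation `π` of `{0, …, i - 1}`: the number of positions `a`
with `a + 1 < i` and `π a < π (a + 1)`. -/
def ascents {i : ℕ} (π : Equiv.Perm (Fin i)) : ℕ :=
  (Finset.univ.filter fun a : Fin i => ∃ h : (a : ℕ) + 1 < i, π a < π ⟨a + 1, h⟩).card

/-- The Eulerian number `A(i, j)`: the number of permutations of a set with `i` elements
that have exactly `j` ascents. -/
def eulerian (i j : ℕ) : ℕ :=
  (Finset.univ.filter fun π : Equiv.Perm (Fin i) => ascents π = j).card

end UniformPowers

end

/-! Write n = 2m, d - 1 = (2m+1)t + q with 0 ≤ q ≤ 2m, and A = R/(x_0^d, …, x_n^d, L^d). Everything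
happens in one multiplication map [A]_{D-1} → [A]_D, where D = 2m(m+1)t + mq + ⌊mq/(2m+1)⌋ =
⌊2m(m+1)(d-1)/(2m+1)⌋. It is never surjective for d > 1 when all coefficients of L are nonzero and
dim [A]_D ≤ dim [A]_{D-1}, and under that inequality maximal rank would force surjectivity.

Non-surjectivity: by Macaulay duality the cokernel of ℓ in degree D is nonzero once there is a
nonzero form G of degree D in 2m+2 variables (one for each d-th power), of degree < d in each
variable, and killed by two derivations with constant coefficients that encode L and ℓ
(`exists_forall_sub_mul_notMem`). Such a G is a product of equations of joins of secant varieties of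
a rational normal curve with coordinate points (`exists_invariant_form`). This needs distinct ratios
of the coefficients of ℓ and L; since surjectivity survives small changes of ℓ
(`finite_not_surjective_add_smul`), ℓ may be moved there.

Dimensions: the strong Lefschetz property of R/(x_0^d, …, x_n^d), proved with an sl₂-action
(`mem_monomialIdeal_of_pow_mul_mem`), reduces the inequality to counting monomials, and the count is
`P m q t` (`P_natCast_eq_card`). Hence P ≤ 0 implies failure (`failureConjecture_of_P_nonpos`),
which gives (b) and (c).

Large d: up to a positive factor, the leading coefficient of P is the second derivative of the
density of a sum of 2m+2 uniform variables on [0,1], at distance (m+1)/(2m+1) from the mean. The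
density is strictly concave there (`leadingSum_neg`), so P is negative for large t, whatever q is;
(a), (d) and (e) follow. -/

noncomputable section

namespace UniformPowers

section Algebra

open MvPolynomial

/-! ### Strong Lefschetz property of monomial complete intersections. -/

section Lefschetz

variable {σ K : Type*} [Fintype σ] [Field K]

/-- The ideal `(x_i ^ d : i ∈ σ)`. -/
def monomialIdeal (σ K : Type*) [Field K] (d : ℕ) : Ideal (MvPolynomial σ K) :=
  Ideal.span (Set.range fun i => X i ^ d)

/-- The lowering operator of the `sl₂`-triple whose raising operator is the multiplication by
`∑ a_i x_i` on `K[x_i : i ∈ σ]/(x_i ^ d)`. -/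
def lowering (a : σ → K) (d : ℕ) (f : MvPolynomial σ K) : MvPolynomial σ K :=
  ∑ i, C (a i)⁻¹ * (((d : MvPolynomial σ K) - 1) * pderiv i f - X i * pderiv i (pderiv i f))

lemma lowering_zero (a : σ → K) (d : ℕ) : lowering a d 0 = 0 := by
  simp [lowering]

lemma lowering_add (a : σ → K) (d : ℕ) (f g : MvPolynomial σ K) :
    lowering a d (f + g) = lowering a d f + lowering a d g := by
  rw [lowering, lowering, lowering, ← Finset.sum_add_distrib]
  refine Finset.sum_congr rfl fun i _ => ?_
  simp only [map_add]
  ring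

lemma lowering_isHomogeneous (a : σ → K) (d : ℕ) {f : MvPolynomial σ K} {j : ℕ}
    (hf : f.IsHomogeneous (j + 1)) : (lowering a d f).IsHomogeneous j := by
  refine IsHomogeneous.sum _ _ _ fun i _ => IsHomogeneous.C_mul (IsHomogeneous.sub ?_ ?_) _
  · have : ((d : MvPolynomial σ K) - 1) = C ((d : K) - 1) := by simp
    rw [this]
    exact (hf.pderiv (i := i)).C_mul _
  · rcases j with _ | j
    · have h1 : (pderiv i f).IsHomogeneous 0 := hf.pderiv (i := i)
      have h2 : pderiv i (pderiv i f) = 0 := by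
        rw [← totalDegree_zero_iff_isHomogeneous, totalDegree_eq_zero_iff_eq_C] at h1
        rw [h1, pderiv_C]
      rw [h2, mul_zero]
      exact isHomogeneous_zero _ _ _
    · have h2 : (pderiv i (pderiv i f)).IsHomogeneous j :=
        (hf.pderiv (i := i)).pderiv (i := i)
      rw [add_comm j 1]
      exact (isHomogeneous_X K i).mul h2

/-- Up to `(a i)⁻¹`, the `i`-th summand sends `x_i ^ k` to `k (d - k) x_i ^ (k - 1)`, so it kills
`x_i ^ d`. Applied to `g * x_i ^ d`, it leaves only multiples of `x_i ^ d`, because the terms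
without a derivative of `g` cancel. -/
lemma lowering_mem_monomialIdeal (a : σ → K) (d : ℕ) {f : MvPolynomial σ K}
    (hf : f ∈ monomialIdeal σ K d) : lowering a d f ∈ monomialIdeal σ K d := by
  classical
  -- The operator is not linear over the polynomial ring, so the induction claim is made for all
  -- multiples `g * f`.
  refine Submodule.span_induction ?_ ?_ ?_ ?_
    (p := fun f _ => ∀ g, lowering a d (g * f) ∈ monomialIdeal σ K d) hf 1 |> (one_mul f ▸ ·)
  · rintro _ ⟨i, rfl⟩ g
    have hX : (X i : MvPolynomial σ K) ^ d ∈ monomialIdeal σ K d :=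
      Ideal.subset_span ⟨i, rfl⟩
    refine Ideal.sum_mem _ fun k _ => Ideal.mul_mem_left _ _ ?_
    rcases eq_or_ne k i with rfl | hk
    · obtain _ | _ | d := d
      · have : monomialIdeal σ K 0 = ⊤ := by
          rw [Ideal.eq_top_iff_one]
          simpa using hX
        simp [this]
      · convert Ideal.mul_mem_left _ (-(2 * pderiv k g + X k * pderiv k (pderiv k g))) hX using 1
        simp only [zero_add, pow_one, Derivation.leibniz, pderiv_X_self, smul_eq_mul, map_add,
          Nat.cast_one, sub_self, zero_mul, zero_sub, mul_one]
        ring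
      · convert Ideal.mul_mem_left _ (((d : MvPolynomial σ K) + 1) * pderiv k g
          - 2 * ((d : MvPolynomial σ K) + 2) * pderiv k g - X k * pderiv k (pderiv k g)) hX using 1
        simp only [Derivation.leibniz, Derivation.leibniz_pow, pderiv_X_self, smul_eq_mul, map_add,
          nsmul_eq_mul, mul_one, Nat.add_sub_cancel]
        push_cast
        simp only [Derivation.map_natCast, map_add, Derivation.map_one_eq_zero,
          mul_zero, add_zero]
        ring_nf
    · have h0 : pderiv k (X i : MvPolynomial σ K) = 0 := pderiv_X_of_ne hk.symm
      convert Ideal.mul_mem_left _ (((d : MvPolynomial σ K) - 1) * pderiv k g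
          - X k * pderiv k (pderiv k g)) hX using 1
      simp only [Derivation.leibniz, Derivation.leibniz_pow, h0, smul_eq_mul,
          mul_zero, smul_zero, zero_add, add_zero]
      ring
  · intro g
    rw [mul_zero, lowering_zero]
    exact zero_mem _
  · intro x y _ _ hx hy g
    rw [mul_add, lowering_add]
    exact add_mem (hx g) (hy g)
  · intro r x _ hx g
    rw [smul_eq_mul, ← mul_assoc]
    exact hx _

/-- The commutator of the lowering operator and the multiplication by `∑ a_i x_i`. -/
lemma lowering_mul_linear {a : σ → K} (ha : ∀ i, a i ≠ 0) {d : ℕ} {f : MvPolynomial σ K}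
    {j : ℕ} (hf : f.IsHomogeneous j) :
    lowering a d ((∑ i, C (a i) * X i) * f) = (∑ i, C (a i) * X i) * lowering a d f
      + C ((Fintype.card σ : K) * ((d : K) - 1) - 2 * j) * f := by
  classical
  set L : MvPolynomial σ K := ∑ i, C (a i) * X i with hL
  have hdL (i : σ) : pderiv i L = C (a i) := by
    simp [hL, Derivation.leibniz, pderiv_X, Pi.single_apply]
  have key (i : σ) : C (a i)⁻¹ * (((d : MvPolynomial σ K) - 1) * pderiv i (L * f)
        - X i * pderiv i (pderiv i (L * f)))
      = L * (C (a i)⁻¹ * (((d : MvPolynomial σ K) - 1) * pderiv i f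
        - X i * pderiv i (pderiv i f)))
        + (((d : MvPolynomial σ K) - 1) * f - 2 * (X i * pderiv i f)) := by
    have hc : C (a i)⁻¹ * C (a i) = (1 : MvPolynomial σ K) := by
      rw [← C_mul, inv_mul_cancel₀ (ha i), C_1]
    simp only [Derivation.leibniz, smul_eq_mul, map_add, hdL, pderiv_C, mul_zero]
    linear_combination (((d : MvPolynomial σ K) - 1) * f - 2 * (X i * pderiv i f)) * hc
  rw [lowering, Finset.sum_congr rfl fun i _ => key i, Finset.sum_add_distrib, ← Finset.mul_sum,
    Finset.sum_sub_distrib, ← Finset.mul_sum Finset.univ _ (2 : MvPolynomial σ K), hf.sum_X_mul_pderiv, lowering]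
  simp only [Finset.sum_const, Finset.card_univ, nsmul_eq_mul, map_sub, map_mul, map_natCast,
    map_one, map_ofNat]
  ring

lemma linear_isHomogeneous (a : σ → K) :
    (∑ i, C (a i) * X i : MvPolynomial σ K).IsHomogeneous 1 :=
  IsHomogeneous.sum _ _ _ fun _ _ => isHomogeneous_C_mul_X _ _

/-- The scalar is the sum of the weights `#σ (d - 1) - 2 (j + i)` for `0 ≤ i ≤ k`. -/
lemma lowering_pow_mul {a : σ → K} (ha : ∀ i, a i ≠ 0) {d : ℕ} {f : MvPolynomial σ K}
    {j : ℕ} (hf : f.IsHomogeneous j) (k : ℕ) :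
    lowering a d ((∑ i, C (a i) * X i) ^ (k + 1) * f)
      = (∑ i, C (a i) * X i) ^ (k + 1) * lowering a d f
      + C (((k : K) + 1) * ((Fintype.card σ : K) * ((d : K) - 1) - 2 * j - k)) *
        ((∑ i, C (a i) * X i) ^ k * f) := by
  induction k with
  | zero =>
    rw [zero_add, pow_one, lowering_mul_linear ha hf]
    simp
  | succ k ih =>
    have h : ((∑ i, C (a i) * X i) ^ (k + 1) * f : MvPolynomial σ K).IsHomogeneous (k + 1 + j) := by
      simpa using ((linear_isHomogeneous a).pow (k + 1)).mul hf
    rw [pow_succ' _ (k + 1), mul_assoc, lowering_mul_linear ha h, ih]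
    simp only [map_sub, map_mul, map_natCast, map_one, map_ofNat, map_add]
    push_cast
    ring

/-- The strong Lefschetz property of `K[x_i : i ∈ σ]/(x_i ^ d)`: up to the middle degree,
the multiplication by powers of `∑ a_i x_i` is injective. -/
theorem mem_monomialIdeal_of_pow_mul_mem [CharZero K] {a : σ → K} (ha : ∀ i, a i ≠ 0) {d : ℕ}
    (hd : 1 ≤ d) (j k : ℕ) (f : MvPolynomial σ K) (hf : f.IsHomogeneous j)
    (hjk : 2 * j + k ≤ Fintype.card σ * (d - 1))
    (h : (∑ i, C (a i) * X i) ^ k * f ∈ monomialIdeal σ K d) : f ∈ monomialIdeal σ K d := by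
  induction j generalizing k f with
  | zero =>
    have h0 : lowering a d f = 0 := by
      rw [← totalDegree_zero_iff_isHomogeneous, totalDegree_eq_zero_iff_eq_C] at hf
      rw [hf]
      simp [lowering]
    induction k with
    | zero => simpa using h
    | succ k ih =>
      refine ih (by omega) ?_
      have h1 := lowering_mem_monomialIdeal a d h
      rw [lowering_pow_mul ha hf, h0, mul_zero, zero_add] at h1
      have hc : ((k : K) + 1) * ((Fintype.card σ : K) * ((d : K) - 1) - 2 * (0 : ℕ) - k) ≠ 0 := by
        refine mul_ne_zero (by exact_mod_cast Nat.succ_ne_zero k) ?_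
        have : ((Fintype.card σ : K) * ((d : K) - 1) - 2 * (0 : ℕ) - k)
            = ((Fintype.card σ * (d - 1) - 2 * 0 - k : ℕ) : K) := by
          rw [Nat.cast_sub (by omega), Nat.cast_sub (by omega)]
          push_cast [Nat.cast_sub hd]
          ring
        rw [this]
        exact_mod_cast (by omega)
      have h2 := Ideal.mul_mem_left _ (C (((k : K) + 1) *
        ((Fintype.card σ : K) * ((d : K) - 1) - 2 * (0 : ℕ) - k))⁻¹) h1
      rwa [← mul_assoc, ← C_mul, inv_mul_cancel₀ hc, C_1, one_mul] at h2
  | succ j ihj =>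
    induction k with
    | zero => simpa using h
    | succ k ih =>
      refine ih (by omega) ?_
      -- Lowering one further multiple, `L ^ (k + 2) * f`, shows that `L ^ (k + 2) * lowering a d f`
      -- is in the ideal. The degree dropped by one and the exponent rose by one, so the outer
      -- induction still applies.
      have hL : lowering a d f ∈ monomialIdeal σ K d := by
        refine ihj (k + 2) _ (lowering_isHomogeneous a d hf) (by omega) ?_
        have h1 := lowering_mem_monomialIdeal a d
          (Ideal.mul_mem_left _ (∑ i, C (a i) * X i) h)
        rw [← mul_assoc, ← pow_succ', lowering_pow_mul ha hf] at h1
        exact (Ideal.add_mem_iff_left _ (Ideal.mul_mem_left _ _ h)).mp h1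
      have h1 := lowering_mem_monomialIdeal a d h
      rw [lowering_pow_mul ha hf,
        Ideal.add_mem_iff_right _ (Ideal.mul_mem_left _ _ hL)] at h1
      -- The degree bound makes the last factor a positive integer, so `L ^ k * f` itself is in the
      -- ideal.
      have hc : ((k : K) + 1) *
          ((Fintype.card σ : K) * ((d : K) - 1) - 2 * (j + 1 : ℕ) - k) ≠ 0 := by
        refine mul_ne_zero (by exact_mod_cast Nat.succ_ne_zero k) ?_
        have : ((Fintype.card σ : K) * ((d : K) - 1) - 2 * (j + 1 : ℕ) - k)
            = ((Fintype.card σ * (d - 1) - 2 * (j + 1) - k : ℕ) : K) := by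
          rw [Nat.cast_sub (by omega), Nat.cast_sub (by omega)]
          push_cast [Nat.cast_sub hd]
          ring
        rw [this]
        exact_mod_cast (by omega)
      have h2 := Ideal.mul_mem_left _ (C (((k : K) + 1) *
        ((Fintype.card σ : K) * ((d : K) - 1) - 2 * (j + 1 : ℕ) - k))⁻¹) h1
      rwa [← mul_assoc, ← C_mul, inv_mul_cancel₀ hc, C_1, one_mul] at h2

end Lefschetz

/-! ### Hilbert functions of the monomial quotient and of the almost complete intersection. -/

section Dimension

lemma finrank_map_add_finrank_inf_ker {K V W : Type*} [Field K] [AddCommGroup V] [Module K V]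
    [AddCommGroup W] [Module K W] (f : V →ₗ[K] W) (p : Submodule K V) [FiniteDimensional K p] :
    Module.finrank K (p.map f) + Module.finrank K ↥(p ⊓ LinearMap.ker f) = Module.finrank K p := by
  have h := (f.domRestrict p).finrank_range_add_finrank_ker
  rw [LinearMap.range_domRestrict, LinearMap.ker_domRestrict] at h
  rw [← h, ← Submodule.map_comap_subtype, Submodule.finrank_map_subtype_eq]

variable {σ K : Type*} [Field K]

lemma mem_monomialIdeal_iff {d : ℕ} {f : MvPolynomial σ K} :
    f ∈ monomialIdeal σ K d ↔ ∀ γ ∈ f.support, ∃ i, d ≤ γ i := by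
  classical
  have h : monomialIdeal σ K d = Ideal.span ((fun s => monomial s (1 : K)) ''
      Set.range fun i => Finsupp.single i d) := by
    rw [monomialIdeal, ← Set.range_comp]
    congr 2
    ext1 i
    simp [X_pow_eq_monomial]
  rw [h, mem_ideal_span_monomial_image]
  simp [Finsupp.single_le_iff]

lemma homogeneousComponent_mem_monomialIdeal {d : ℕ} {f : MvPolynomial σ K}
    (hf : f ∈ monomialIdeal σ K d) (j : ℕ) :
    homogeneousComponent j f ∈ monomialIdeal σ K d := by
  rw [mem_monomialIdeal_iff] at hf ⊢
  intro γ hγ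
  refine hf γ ?_
  rw [support_homogeneousComponent] at hγ
  exact (Finset.mem_filter.mp hγ).1

lemma homogeneousComponent_mul {p : MvPolynomial σ K} {d : ℕ} (hp : p.IsHomogeneous d)
    (f : MvPolynomial σ K) (j : ℕ) :
    homogeneousComponent j (p * f) = if d ≤ j then p * homogeneousComponent (j - d) f else 0 := by
  have key (i : ℕ) : homogeneousComponent j (p * homogeneousComponent i f)
      = if j = d + i then p * homogeneousComponent i f else 0 :=
    homogeneousComponent_of_mem (hp.mul (homogeneousComponent_isHomogeneous i f))
  conv_lhs => rw [← sum_homogeneousComponent f]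
  rw [Finset.mul_sum, map_sum, Finset.sum_congr rfl fun i _ => key i]
  split_ifs with hd
  · rw [Finset.sum_eq_single (j - d)]
    · rw [if_pos (by omega)]
    · intro i _ hi
      exact if_neg (by omega)
    · intro h
      rw [homogeneousComponent_eq_zero _ _ (by simp only [Finset.mem_range] at h; omega)]
      simp
  · exact Finset.sum_eq_zero fun i _ => if_neg (by omega)

variable [Fintype σ]

instance (j : ℕ) : FiniteDimensional K (homogeneousSubmodule σ K j) :=
  Module.Finite.iff_fg.mpr (homogeneousSubmodule_fg σ K j)

lemma finrank_gradedPiece_add (I : Ideal (MvPolynomial σ K)) (j : ℕ) :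
    Module.finrank K (gradedPiece I j)
      + Module.finrank K ↥(homogeneousSubmodule σ K j ⊓ I.restrictScalars K)
      = Module.finrank K (homogeneousSubmodule σ K j) := by
  have h : LinearMap.ker (Ideal.Quotient.mkₐ K I).toLinearMap = I.restrictScalars K := by
    ext x
    simp [Ideal.Quotient.eq_zero_iff_mem]
  have h1 := finrank_map_add_finrank_inf_ker (Ideal.Quotient.mkₐ K I).toLinearMap
    (homogeneousSubmodule σ K j)
  rwa [h] at h1

/-- The exponent vectors of the monomials of degree `j` with all exponents less than `d`. -/
def boundedExponents (σ : Type*) [Fintype σ] (d j : ℕ) : Finset (σ → ℕ) := by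
  classical
  exact (Fintype.piFinset fun _ : σ => Finset.range d).filter fun γ => ∑ i, γ i = j

lemma mem_boundedExponents {d j : ℕ} {γ : σ → ℕ} :
    γ ∈ boundedExponents σ d j ↔ (∀ i, γ i < d) ∧ ∑ i, γ i = j := by
  simp [boundedExponents]

lemma finrank_gradedPiece_monomialIdeal (d j : ℕ) :
    Module.finrank K (gradedPiece (monomialIdeal σ K d) j) = (boundedExponents σ d j).card := by
  classical
  let v : boundedExponents σ d j → MvPolynomial σ K ⧸ monomialIdeal σ K d := fun γ =>
    Ideal.Quotient.mkₐ K _ (monomial (Finsupp.equivFunOnFinite.symm γ.1) 1)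
  have hv : LinearIndependent K v := by
    rw [Fintype.linearIndependent_iff]
    intro c hc γ
    have h1 : ∑ δ, monomial (Finsupp.equivFunOnFinite.symm δ.1) (c δ)
        ∈ monomialIdeal σ K d := by
      rw [← Ideal.Quotient.eq_zero_iff_mem, ← Ideal.Quotient.mkₐ_eq_mk K, map_sum, ← hc]
      refine Finset.sum_congr rfl fun δ _ => ?_
      rw [← map_smul, smul_monomial, smul_eq_mul, mul_one]
    by_contra h0
    obtain ⟨i, hi⟩ := mem_monomialIdeal_iff.mp h1 (Finsupp.equivFunOnFinite.symm γ.1) (by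
      rw [mem_support_iff, coeff_sum, Finset.sum_eq_single γ]
      · simpa using h0
      · intro δ _ hδ
        rw [coeff_monomial, if_neg]
        exact fun h => hδ (Subtype.ext (Finsupp.equivFunOnFinite.symm.injective h))
      · simp)
    have := (mem_boundedExponents.mp γ.2).1 i
    simp only [Finsupp.equivFunOnFinite_symm_apply_apply] at hi
    omega
  have hspan : gradedPiece (monomialIdeal σ K d) j = Submodule.span K (Set.range v) := by
    refine le_antisymm ?_ (Submodule.span_le.mpr ?_)
    · rintro _ ⟨f, hf, rfl⟩
      rw [SetLike.mem_coe, mem_homogeneousSubmodule] at hf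
      rw [f.as_sum, map_sum]
      refine Submodule.sum_mem _ fun γ hγ => ?_
      by_cases hb : ∀ i, γ i < d
      · have hm : (γ : σ → ℕ) ∈ boundedExponents σ d j := by
          refine mem_boundedExponents.mpr ⟨hb, ?_⟩
          rw [← Finsupp.degree_eq_sum]
          by_contra h
          exact mem_support_iff.mp hγ (hf.coeff_eq_zero h)
        have h2 : monomial γ (coeff γ f) = coeff γ f •
            monomial (Finsupp.equivFunOnFinite.symm (γ : σ → ℕ)) (1 : K) := by
          simp [smul_monomial]
        rw [h2, map_smul]
        exact Submodule.smul_mem _ _ (Submodule.subset_span ⟨⟨_, hm⟩, rfl⟩)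
      · push Not at hb
        have h3 : monomial γ (coeff γ f) ∈ monomialIdeal σ K d := by
          rw [mem_monomialIdeal_iff]
          intro δ hδ
          rwa [Finset.mem_singleton.mp (support_monomial_subset hδ)]
        have h4 : (Ideal.Quotient.mkₐ K (monomialIdeal σ K d)).toLinearMap
            (monomial γ (coeff γ f)) = 0 := Ideal.Quotient.eq_zero_iff_mem.mpr h3
        rw [h4]
        exact zero_mem _
    · rintro _ ⟨γ, rfl⟩
      refine ⟨_, ?_, rfl⟩
      rw [SetLike.mem_coe, mem_homogeneousSubmodule]
      refine isHomogeneous_monomial _ ?_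
      rw [Finsupp.degree_eq_sum]
      exact (mem_boundedExponents.mp γ.2).2
  rw [hspan, finrank_span_eq_card hv, Fintype.card_coe]

section PowerIdeal

variable {n : ℕ} (a : Fin (n + 1) → K) (d : ℕ)

lemma powerIdeal_eq_sup (L : MvPolynomial (Fin (n + 1)) K) :
    powerIdeal L d = monomialIdeal _ K d ⊔ Ideal.span {L ^ d} :=
  Ideal.span_union _ _

lemma monomialIdeal_le_powerIdeal (L : MvPolynomial (Fin (n + 1)) K) :
    monomialIdeal _ K d ≤ powerIdeal L d :=
  (powerIdeal_eq_sup d L).symm ▸ le_sup_left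

lemma linearForm_pow_isHomogeneous : (linearForm a ^ d).IsHomogeneous d := by
  rw [linearForm]
  simpa using (linear_isHomogeneous a).pow d

lemma finrank_gradedPiece_powerIdeal (j : ℕ) :
    Module.finrank K (gradedPiece (powerIdeal (linearForm a) d) j)
      + Module.finrank K ((homogeneousSubmodule _ K j ⊓
          (powerIdeal (linearForm a) d).restrictScalars K).map
            (Ideal.Quotient.mkₐ K (monomialIdeal _ K d)).toLinearMap)
      = (boundedExponents (Fin (n + 1)) d j).card := by
  have h1 := finrank_gradedPiece_add (powerIdeal (linearForm a) d) j
  have h2 := finrank_gradedPiece_add (monomialIdeal (Fin (n + 1)) K d) j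
  have h3 := finrank_map_add_finrank_inf_ker
    (Ideal.Quotient.mkₐ K (monomialIdeal (Fin (n + 1)) K d)).toLinearMap
    (homogeneousSubmodule _ K j ⊓ (powerIdeal (linearForm a) d).restrictScalars K)
  have h4 : homogeneousSubmodule _ K j ⊓ (powerIdeal (linearForm a) d).restrictScalars K ⊓
      LinearMap.ker (Ideal.Quotient.mkₐ K (monomialIdeal (Fin (n + 1)) K d)).toLinearMap
      = homogeneousSubmodule _ K j ⊓ (monomialIdeal (Fin (n + 1)) K d).restrictScalars K := by
    ext x
    simp only [Submodule.mem_inf, Submodule.restrictScalars_mem, LinearMap.mem_ker,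
      AlgHom.toLinearMap_apply, Ideal.Quotient.mkₐ_eq_mk, Ideal.Quotient.eq_zero_iff_mem]
    exact ⟨fun h => ⟨h.1.1, h.2⟩, fun h => ⟨⟨h.1, monomialIdeal_le_powerIdeal d _ h.2⟩, h.2⟩⟩
  rw [h4] at h3
  rw [finrank_gradedPiece_monomialIdeal] at h2
  omega

/-- Take the degree `j` component of `u + w * L ^ d`: the component of `u` stays in the monomial
ideal, which is homogeneous, and only the degree `j - d` component of `w` contributes. -/
lemma map_inf_powerIdeal_of_le {j : ℕ} (hd : d ≤ j) :
    (homogeneousSubmodule _ K j ⊓ (powerIdeal (linearForm a) d).restrictScalars K).map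
      (Ideal.Quotient.mkₐ K (monomialIdeal _ K d)).toLinearMap
    = (homogeneousSubmodule (Fin (n + 1)) K (j - d)).map
      ((Ideal.Quotient.mkₐ K (monomialIdeal _ K d)).toLinearMap ∘ₗ
        LinearMap.mulLeft K (linearForm a ^ d)) := by
  apply le_antisymm
  · rintro _ ⟨f, ⟨hf, hfI⟩, rfl⟩
    simp only [Submodule.coe_restrictScalars, SetLike.mem_coe, powerIdeal_eq_sup,
      Submodule.mem_sup, Ideal.mem_span_singleton'] at hfI
    obtain ⟨u, hu, _, ⟨w, rfl⟩, rfl⟩ := hfI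
    refine ⟨homogeneousComponent (j - d) w, homogeneousComponent_mem _ _, ?_⟩
    have h := homogeneousComponent_of_mem (m := j) hf
    rw [if_pos rfl, map_add, mul_comm w,
      homogeneousComponent_mul (linearForm_pow_isHomogeneous a d), if_pos hd] at h
    rw [mul_comm w, ← h]
    simp only [LinearMap.comp_apply, LinearMap.mulLeft_apply, map_add]
    have h0 : (Ideal.Quotient.mkₐ K (monomialIdeal (Fin (n + 1)) K d)).toLinearMap
        (homogeneousComponent j u) = 0 :=
      Ideal.Quotient.eq_zero_iff_mem.mpr (homogeneousComponent_mem_monomialIdeal hu j)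
    rw [h0, zero_add]
  · rintro _ ⟨f, hf, rfl⟩
    refine ⟨linearForm a ^ d * f, ⟨?_, ?_⟩, rfl⟩
    · have := (linearForm_pow_isHomogeneous a d).mul ((mem_homogeneousSubmodule _ _).mp hf)
      rwa [Nat.add_sub_cancel' hd] at this
    · exact Ideal.mul_mem_right _ _ (Ideal.subset_span (Or.inr rfl))

lemma map_inf_powerIdeal_of_lt {j : ℕ} (hd : j < d) :
    (homogeneousSubmodule _ K j ⊓ (powerIdeal (linearForm a) d).restrictScalars K).map
      (Ideal.Quotient.mkₐ K (monomialIdeal _ K d)).toLinearMap = ⊥ := by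
  rw [eq_bot_iff]
  rintro _ ⟨f, ⟨hf, hfI⟩, rfl⟩
  simp only [Submodule.coe_restrictScalars, SetLike.mem_coe, powerIdeal_eq_sup,
    Submodule.mem_sup, Ideal.mem_span_singleton'] at hfI
  obtain ⟨u, hu, _, ⟨w, rfl⟩, rfl⟩ := hfI
  have h := homogeneousComponent_of_mem (m := j) hf
  rw [if_pos rfl, map_add, mul_comm w,
    homogeneousComponent_mul (linearForm_pow_isHomogeneous a d), if_neg (by omega),
    add_zero] at h
  rw [mul_comm w, ← h, Submodule.mem_bot]
  exact Ideal.Quotient.eq_zero_iff_mem.mpr (homogeneousComponent_mem_monomialIdeal hu j)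

lemma finrank_map_mul_le (j : ℕ) :
    Module.finrank K ((homogeneousSubmodule (Fin (n + 1)) K j).map
      ((Ideal.Quotient.mkₐ K (monomialIdeal _ K d)).toLinearMap ∘ₗ
        LinearMap.mulLeft K (linearForm a ^ d))) ≤ (boundedExponents (Fin (n + 1)) d j).card := by
  rw [← finrank_gradedPiece_monomialIdeal (K := K)]
  have h1 := finrank_gradedPiece_add (monomialIdeal (Fin (n + 1)) K d) j
  have h2 := finrank_map_add_finrank_inf_ker
    ((Ideal.Quotient.mkₐ K (monomialIdeal (Fin (n + 1)) K d)).toLinearMap ∘ₗ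
        LinearMap.mulLeft K (linearForm a ^ d)) (homogeneousSubmodule _ K j)
  have h3 : homogeneousSubmodule _ K j ⊓ (monomialIdeal (Fin (n + 1)) K d).restrictScalars K ≤
      homogeneousSubmodule _ K j ⊓
      LinearMap.ker ((Ideal.Quotient.mkₐ K (monomialIdeal (Fin (n + 1)) K d)).toLinearMap ∘ₗ
        LinearMap.mulLeft K (linearForm a ^ d)) :=
    inf_le_inf_left _ fun f hf =>
      Ideal.Quotient.eq_zero_iff_mem.mpr (Ideal.mul_mem_left _ (linearForm a ^ d) hf)
  have h4 := Submodule.finrank_mono h3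
  omega

variable {a}

/-- By the strong Lefschetz property, a form of degree `j` killed by `L ^ d` already lies in the
monomial ideal. -/
lemma finrank_map_mul_eq [CharZero K] (ha : ∀ i, a i ≠ 0) (hd : 1 ≤ d) {j : ℕ}
    (hj : 2 * j + d ≤ (n + 1) * (d - 1)) :
    Module.finrank K ((homogeneousSubmodule (Fin (n + 1)) K j).map
      ((Ideal.Quotient.mkₐ K (monomialIdeal _ K d)).toLinearMap ∘ₗ
        LinearMap.mulLeft K (linearForm a ^ d))) = (boundedExponents (Fin (n + 1)) d j).card := by
  rw [← finrank_gradedPiece_monomialIdeal (K := K)]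
  have h1 := finrank_gradedPiece_add (monomialIdeal (Fin (n + 1)) K d) j
  have h2 := finrank_map_add_finrank_inf_ker
    ((Ideal.Quotient.mkₐ K (monomialIdeal (Fin (n + 1)) K d)).toLinearMap ∘ₗ
        LinearMap.mulLeft K (linearForm a ^ d)) (homogeneousSubmodule _ K j)
  have h3 : homogeneousSubmodule _ K j ⊓
      LinearMap.ker ((Ideal.Quotient.mkₐ K (monomialIdeal (Fin (n + 1)) K d)).toLinearMap ∘ₗ
        LinearMap.mulLeft K (linearForm a ^ d)) ≤
      homogeneousSubmodule _ K j ⊓ (monomialIdeal (Fin (n + 1)) K d).restrictScalars K :=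
    fun f hf => ⟨hf.1, mem_monomialIdeal_of_pow_mul_mem ha hd j d f hf.1 (by simpa using hj)
      (Ideal.Quotient.eq_zero_iff_mem.mp hf.2)⟩
  have h4 := Submodule.finrank_mono h3
  have h5 := finrank_map_mul_le a d j
  rw [← finrank_gradedPiece_monomialIdeal (K := K)] at h5
  omega

/-- The comparison of the dimensions of consecutive graded pieces of
`K[x_0, …, x_n]/(x_0 ^ d, …, x_n ^ d, L ^ d)` is reduced to a count of monomials. -/
theorem finrank_gradedPiece_succ_le [CharZero K] (ha : ∀ i, a i ≠ 0) (hd : 1 ≤ d) {j : ℕ}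
    (hdj : d ≤ j + 1) (hj : 2 * (j + 1 - d) + d ≤ (n + 1) * (d - 1))
    (hcard : (boundedExponents (Fin (n + 1)) d (j + 1)).card
        + (if d ≤ j then (boundedExponents (Fin (n + 1)) d (j - d)).card else 0)
      ≤ (boundedExponents (Fin (n + 1)) d j).card
        + (boundedExponents (Fin (n + 1)) d (j + 1 - d)).card) :
    Module.finrank K (gradedPiece (powerIdeal (linearForm a) d) (j + 1))
      ≤ Module.finrank K (gradedPiece (powerIdeal (linearForm a) d) j) := by
  have h1 := finrank_gradedPiece_powerIdeal a d (j + 1)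
  have h2 := finrank_gradedPiece_powerIdeal a d j
  -- The exact rank of `L ^ d` is needed only in degree `j + 1`; in degree `j` the trivial upper
  -- bound points the right way.
  rw [map_inf_powerIdeal_of_le a d hdj, finrank_map_mul_eq d ha hd hj] at h1
  split_ifs at hcard with h
  · rw [map_inf_powerIdeal_of_le a d h] at h2
    have := finrank_map_mul_le a d (j - d)
    omega
  · rw [map_inf_powerIdeal_of_lt a d (by omega), finrank_bot] at h2
    omega

end PowerIdeal
end Dimension

/-! ### Translation-invariant forms from secant varieties of rational normal curves. -/

section SecantForm

variable {ι K : Type*} [DecidableEq ι] [Field K]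

/-- The coefficient of `∏ i ∈ S, z i` in the equation `secantForm α p E k`. -/
def secantCoeff (α p : ι → K) (E S : Finset ι) : K :=
  (∏ i ∈ S, (α i)⁻¹) * ∏ i ∈ S, ∏ j ∈ E \ S, (p i - p j)⁻¹

/-- The squarefree form of degree `k` in the variables `z i`, `i ∈ E`, which defines, for
`#E = 2 k + 1`, the join of the `k - 1`-st secant variety of the rational normal curve through
`#ι` points in `ℙ^(#ι - 3)` with the linear span of the points whose index is not in `E`. -/
def secantForm (α p : ι → K) (E : Finset ι) (k : ℕ) : MvPolynomial ι K :=
  ∑ S ∈ E.powersetCard k, C (secantCoeff α p E S) * ∏ i ∈ S, X i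

lemma prod_X_eq_monomial (S : Finset ι) :
    (∏ i ∈ S, X i : MvPolynomial ι K) = monomial (Finsupp.indicator S fun _ _ => 1) 1 := by
  rw [monomial_eq, C_1, one_mul, Finsupp.prod_of_support_subset (s := S)]
  · exact Finset.prod_congr rfl fun i hi => by simp [hi]
  · exact Finsupp.support_indicator_subset _ _
  · simp

lemma secantForm_isHomogeneous (α p : ι → K) (E : Finset ι) (k : ℕ) :
    (secantForm α p E k).IsHomogeneous k := by
  refine IsHomogeneous.sum _ _ _ fun S hS => IsHomogeneous.C_mul ?_ _
  have := IsHomogeneous.prod S (X : ι → MvPolynomial ι K) (fun _ => 1)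
    fun i _ => isHomogeneous_X K i
  simpa [(Finset.mem_powersetCard.mp hS).2] using this

lemma degreeOf_secantForm_le (α p : ι → K) (E : Finset ι) (k : ℕ) (i : ι) :
    degreeOf i (secantForm α p E k) ≤ if i ∈ E then 1 else 0 := by
  refine (degreeOf_sum_le _ _ _).trans (Finset.sup_le fun S hS => ?_)
  refine (degreeOf_C_mul_le _ _ _).trans ?_
  rw [prod_X_eq_monomial]
  rw [degreeOf_monomial_eq _ _ one_ne_zero]
  by_cases h : i ∈ S
  · simp [h, (Finset.mem_powersetCard.mp hS).1 h]
  · simp [h]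

lemma secantForm_ne_zero {α p : ι → K} (hα : ∀ i, α i ≠ 0) (hp : Function.Injective p)
    {E : Finset ι} {k : ℕ} (hk : k ≤ E.card) : secantForm α p E k ≠ 0 := by
  obtain ⟨S, hSE, hS⟩ := Finset.exists_subset_card_eq hk
  have hcoeff : coeff (Finsupp.indicator S fun _ _ => 1) (secantForm α p E k)
      = secantCoeff α p E S := by
    rw [secantForm, coeff_sum, Finset.sum_eq_single S]
    · rw [prod_X_eq_monomial, coeff_C_mul, coeff_monomial, if_pos rfl, mul_one]
    · intro T _ hT
      rw [prod_X_eq_monomial, coeff_C_mul, coeff_monomial, if_neg, mul_zero]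
      intro h
      refine hT (Finset.ext fun i => ?_)
      have := DFunLike.congr_fun h i
      rw [Finsupp.indicator_apply, Finsupp.indicator_apply] at this
      split_ifs at this <;> tauto
    · intro h
      exact absurd (Finset.mem_powersetCard.mpr ⟨hSE, hS⟩) h
  intro h
  rw [h, coeff_zero] at hcoeff
  refine (mul_ne_zero ?_ ?_) hcoeff.symm
  · exact Finset.prod_ne_zero_iff.mpr fun i _ => inv_ne_zero (hα i)
  · refine Finset.prod_ne_zero_iff.mpr fun i hi => Finset.prod_ne_zero_iff.mpr fun j hj => ?_
    refine inv_ne_zero (sub_ne_zero.mpr fun h => ?_)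
    exact (Finset.mem_sdiff.mp hj).2 (hp h ▸ hi)

/-- The identity behind the translation invariance of `secantForm`; it is Lagrange interpolation
at the points `p i`, `i ∈ E \ T`. -/
lemma sum_secantCoeff_insert {α p : ι → K} (hα : ∀ i, α i ≠ 0) (hp : Function.Injective p)
    {E T : Finset ι} (hT : T ⊆ E) (hcard : E.card = 2 * T.card + 3) {f : Polynomial K}
    (hf : f.natDegree ≤ 1) :
    ∑ i ∈ E \ T, α i * f.eval (p i) * secantCoeff α p E (insert i T) = 0 := by
  set U := E \ T with hU
  have hUc : U.card = T.card + 3 := by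
    rw [hU, Finset.card_sdiff_of_subset hT]
    omega
  -- The factor `p t - p i` restores the index `i` missing from `E \ insert i T`. The sum becomes
  -- Lagrange's formula for the coefficient of `g` in degree `#U - 1 = #T + 2`, which exceeds
  -- `natDegree g ≤ #T + 1`.
  let g : Polynomial K := f * ∏ t ∈ T, (Polynomial.C (p t) - Polynomial.X)
  have h1 : (∏ t ∈ T, (Polynomial.C (p t) - Polynomial.X)).natDegree ≤ T.card := by
    refine (Polynomial.natDegree_prod_le _ _).trans ?_
    refine (Finset.sum_le_card_nsmul _ _ 1 fun t _ => ?_).trans (by simp)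
    compute_degree
  have h2 : g.natDegree ≤ 1 + T.card := Polynomial.natDegree_mul_le_of_le hf h1
  have hg : g.degree < (U.card : WithBot ℕ) := by
    refine Polynomial.degree_le_natDegree.trans_lt ?_
    exact_mod_cast (by omega : g.natDegree < U.card)
  have hlag := Lagrange.coeff_eq_sum (hp.injOn (s := (U : Set ι))) hg
  rw [Polynomial.coeff_eq_zero_of_natDegree_lt (by omega)] at hlag
  rw [← mul_zero ((∏ t ∈ T, (α t)⁻¹) * ∏ t ∈ T, ∏ j ∈ U, (p t - p j)⁻¹), hlag, Finset.mul_sum]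
  refine Finset.sum_congr rfl fun i hi => ?_
  have hiT : i ∉ T := (Finset.mem_sdiff.mp hi).2
  have hE : E \ insert i T = U.erase i := by
    rw [hU, Finset.sdiff_insert]
  have hprod (t : ι) (ht : t ∈ T) :
      ∏ j ∈ U.erase i, (p t - p j)⁻¹ = (p t - p i) * ∏ j ∈ U, (p t - p j)⁻¹ := by
    have h0 : p t - p i ≠ 0 := sub_ne_zero.mpr fun h => hiT (hp h ▸ ht)
    rw [← Finset.mul_prod_erase U _ hi, mul_inv_cancel_left₀ h0]
  rw [secantCoeff, Finset.prod_insert hiT, Finset.prod_insert hiT, hE,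
    Finset.prod_congr rfl hprod, Finset.prod_mul_distrib, Finset.prod_inv_distrib (s := U.erase i),
    Polynomial.eval_mul, Polynomial.eval_prod]
  simp only [Polynomial.eval_sub, Polynomial.eval_C, Polynomial.eval_X]
  rw [div_eq_mul_inv]
  linear_combination (Polynomial.eval (p i) f * (∏ t ∈ T, (α t)⁻¹) *
    (∏ j ∈ U.erase i, (p i - p j))⁻¹ * (∏ t ∈ T, (p t - p i)) *
    ∏ t ∈ T, ∏ j ∈ U, (p t - p j)⁻¹) * mul_inv_cancel₀ (hα i)

lemma sum_powersetCard_succ {M : Type*} [AddCommMonoid M] (E : Finset ι) (k : ℕ)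
    (F : Finset ι → ι → M) :
    ∑ S ∈ E.powersetCard (k + 1), ∑ i ∈ S, F S i
      = ∑ T ∈ E.powersetCard k, ∑ i ∈ E \ T, F (insert i T) i := by
  rw [Finset.sum_sigma', Finset.sum_sigma']
  refine Finset.sum_bij' (fun x _ => ⟨x.1.erase x.2, x.2⟩) (fun x _ => ⟨insert x.2 x.1, x.2⟩)
    ?_ ?_ ?_ ?_ ?_
  · rintro ⟨S, i⟩ h
    simp only [Finset.mem_sigma, Finset.mem_powersetCard] at h
    obtain ⟨⟨h1, h2⟩, h3⟩ := h
    simp only [Finset.mem_sigma, Finset.mem_powersetCard, Finset.mem_sdiff]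
    exact ⟨⟨(Finset.erase_subset _ _).trans h1, by rw [Finset.card_erase_of_mem h3]; omega⟩,
      h1 h3, Finset.notMem_erase _ _⟩
  · rintro ⟨T, i⟩ h
    simp only [Finset.mem_sigma, Finset.mem_powersetCard, Finset.mem_sdiff] at h
    obtain ⟨⟨h1, h2⟩, h3, h4⟩ := h
    simp only [Finset.mem_sigma, Finset.mem_powersetCard]
    exact ⟨⟨Finset.insert_subset h3 h1, by rw [Finset.card_insert_of_notMem h4, h2]⟩,
      Finset.mem_insert_self _ _⟩
  · rintro ⟨S, i⟩ h
    simp only [Finset.mem_sigma] at h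
    simp [Finset.insert_erase h.2]
  · rintro ⟨T, i⟩ h
    simp only [Finset.mem_sigma, Finset.mem_sdiff] at h
    simp [Finset.erase_insert h.2.2]
  · rintro ⟨S, i⟩ h
    simp only [Finset.mem_sigma] at h
    simp [Finset.insert_erase h.2]

omit [DecidableEq ι] in
lemma derivation_prod_eq_zero (D : Derivation K (MvPolynomial ι K) (MvPolynomial ι K))
    {τ : Type*} (s : Finset τ) (F : τ → MvPolynomial ι K) (h : ∀ i ∈ s, D (F i) = 0) :
    D (∏ i ∈ s, F i) = 0 := by
  classical
  induction s using Finset.induction_on with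
  | empty => exact D.map_one_eq_zero
  | insert i s hi ih =>
    rw [Finset.prod_insert hi, D.leibniz, h i (Finset.mem_insert_self _ _),
      ih fun j hj => h j (Finset.mem_insert_of_mem hj), smul_zero, smul_zero, add_zero]

lemma pderiv_prod_X (i : ι) (S : Finset ι) :
    pderiv i (∏ j ∈ S, X j : MvPolynomial ι K) = if i ∈ S then ∏ j ∈ S.erase i, X j else 0 := by
  split_ifs with h
  · rw [← Finset.mul_prod_erase S _ h, Derivation.leibniz, pderiv_X_self,
      derivation_prod_eq_zero _ _ _ fun j hj => pderiv_X_of_ne (Finset.ne_of_mem_erase hj)]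
    simp
  · exact derivation_prod_eq_zero _ _ _ fun j hj => pderiv_X_of_ne fun h' => h (h' ▸ hj)

/-- The derivation `∑ β_i ∂/∂z_i`. -/
def dirDeriv [Fintype ι] (β : ι → K) :
    Derivation K (MvPolynomial ι K) (MvPolynomial ι K) :=
  ∑ i, β i • pderiv i

omit [DecidableEq ι] in
lemma dirDeriv_apply [Fintype ι] (β : ι → K) (G : MvPolynomial ι K) :
    dirDeriv β G = ∑ i, β i • pderiv i G := by
  have h : (⇑(∑ i, β i • pderiv i : Derivation K (MvPolynomial ι K) (MvPolynomial ι K)))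
      = ∑ i, ⇑(β i • pderiv i : Derivation K (MvPolynomial ι K) (MvPolynomial ι K)) :=
    map_sum Derivation.coeFnAddMonoidHom _ _
  rw [dirDeriv, h, Finset.sum_apply]
  rfl

/-- The coefficient of each `∏ j ∈ T, X j` in the derivative is the interpolation sum of
`sum_secantCoeff_insert`. The choices `f = 1` and `f = X` give the two required derivations. -/
lemma dirDeriv_secantForm [Fintype ι] {α p : ι → K} (hα : ∀ i, α i ≠ 0)
    (hp : Function.Injective p) {E : Finset ι} {k : ℕ} (hE : E.card = 2 * k + 1)
    {f : Polynomial K} (hf : f.natDegree ≤ 1) :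
    dirDeriv (fun i => α i * f.eval (p i)) (secantForm α p E k) = 0 := by
  have h1 : dirDeriv (fun i => α i * f.eval (p i)) (secantForm α p E k)
      = ∑ S ∈ E.powersetCard k, ∑ i ∈ S,
        C (α i * f.eval (p i) * secantCoeff α p E S) * ∏ j ∈ S.erase i, X j := by
    rw [secantForm, map_sum]
    refine Finset.sum_congr rfl fun S _ => ?_
    rw [dirDeriv_apply, ← Finset.sum_subset (Finset.subset_univ S)]
    · refine Finset.sum_congr rfl fun i hi => ?_
      rw [pderiv_C_mul, pderiv_prod_X, if_pos hi, smul_eq_C_mul, ← mul_assoc,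
        ← C_mul]
    · intro i _ hi
      rw [pderiv_C_mul, pderiv_prod_X, if_neg hi, mul_zero, smul_zero]
  rw [h1]
  obtain _ | k := k
  · simp
  · rw [sum_powersetCard_succ]
    refine Finset.sum_eq_zero fun T hT => ?_
    obtain ⟨hTE, hTk⟩ := Finset.mem_powersetCard.mp hT
    have h2 (i : ι) (hi : i ∈ E \ T) :
        C (α i * f.eval (p i) * secantCoeff α p E (insert i T)) *
          ∏ j ∈ (insert i T).erase i, X j
        = C (α i * f.eval (p i) * secantCoeff α p E (insert i T)) *
          (∏ j ∈ T, X j : MvPolynomial ι K) := by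
      rw [Finset.erase_insert (Finset.mem_sdiff.mp hi).2]
    rw [Finset.sum_congr rfl h2, ← Finset.sum_mul, ← map_sum,
      sum_secantCoeff_insert hα hp hTE (by omega) hf, C_0, zero_mul]

/-- A nonzero form of degree `2 m (m + 1) t + m q + ⌊m q / (2 m + 1)⌋` in `2 m + 2` variables, of
degree at most `(2 m + 1) t + q` in each of them, which is invariant under the translations by two
given vectors. -/
theorem exists_invariant_form [Fintype ι] {m : ℕ} (hι : Fintype.card ι = 2 * m + 2)
    {α p : ι → K} (hα : ∀ i, α i ≠ 0) (hp : Function.Injective p) {q : ℕ} (hq : q ≤ 2 * m)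
    (t : ℕ) :
    ∃ G : MvPolynomial ι K, G ≠ 0 ∧
      G.IsHomogeneous (2 * m * (m + 1) * t + m * q + m * q / (2 * m + 1)) ∧
      (∀ i, degreeOf i G ≤ (2 * m + 1) * t + q) ∧
      dirDeriv α G = 0 ∧ dirDeriv (fun i => α i * p i) G = 0 := by
  set e := m * q / (2 * m + 1) with he
  -- An invariant secant form of degree `e` uses `2 * e + 1` variables, here chosen within a set `Q`
  -- of size `q`.
  have heq : q = 0 ∧ e = 0 ∨ 2 * e + 1 ≤ q := by
    rcases Nat.eq_zero_or_pos q with h | h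
    · exact Or.inl ⟨h, by simp [he, h]⟩
    · right
      have h1 : e * (2 * m + 1) ≤ m * q := Nat.div_mul_le_self _ _
      by_contra h2
      have h3 : q ≤ 2 * e := by omega
      nlinarith
  obtain ⟨Q, hQ⟩ : ∃ Q : Finset ι, Q.card = q := by
    obtain ⟨Q, -, hQ⟩ := Finset.exists_subset_card_eq (s := (Finset.univ : Finset ι)) (n := q)
      (by rw [Finset.card_univ]; omega)
    exact ⟨Q, hQ⟩
  obtain ⟨H, hH0, hHh, hHd, hHD⟩ : ∃ H : MvPolynomial ι K, H ≠ 0 ∧ H.IsHomogeneous e ∧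
      (∀ i, degreeOf i H ≤ if i ∈ Q then 1 else 0) ∧
      ∀ f : Polynomial K, f.natDegree ≤ 1 → dirDeriv (fun i => α i * f.eval (p i)) H = 0 := by
    rcases heq with ⟨-, h⟩ | h
    · refine ⟨1, one_ne_zero, h ▸ isHomogeneous_one _ _, fun i => ?_, fun f _ => ?_⟩
      · simp [degreeOf_one]
      · exact Derivation.map_one_eq_zero _
    · obtain ⟨E, hEQ, hE⟩ := Finset.exists_subset_card_eq (hQ.symm ▸ h)
      refine ⟨secantForm α p E e, secantForm_ne_zero hα hp (by omega),
        secantForm_isHomogeneous _ _ _ _, fun i => ?_, fun f hf => dirDeriv_secantForm hα hp hE hf⟩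
      refine (degreeOf_secantForm_le _ _ _ _ _).trans ?_
      by_cases hi : i ∈ E
      · simp [hi, hEQ hi]
      · simp [hi]
  -- `F i` omits the variable `i`, so `∏ i, F i` has degree at most `2 * m + 1` in each variable.
  -- Likewise `∏ i ∈ Q, F i` has degree at most `q - 1` in the variables from `Q`, leaving room for
  -- the squarefree factor `H`.
  let F (i : ι) : MvPolynomial ι K := secantForm α p (Finset.univ.erase i) m
  have hcard (i : ι) : (Finset.univ.erase i).card = 2 * m + 1 := by
    rw [Finset.card_erase_of_mem (Finset.mem_univ i), Finset.card_univ, hι]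
    omega
  have hF0 (i : ι) : F i ≠ 0 := secantForm_ne_zero hα hp (by rw [hcard]; omega)
  have hFh (i : ι) : (F i).IsHomogeneous m := secantForm_isHomogeneous _ _ _ _
  have hFd (i j : ι) : degreeOf i (F j) ≤ if i = j then 0 else 1 := by
    refine (degreeOf_secantForm_le _ _ _ _ _).trans ?_
    by_cases h : i = j <;> simp [h]
  have hFD (i : ι) (f : Polynomial K) (hf : f.natDegree ≤ 1) :
      dirDeriv (fun i => α i * f.eval (p i)) (F i) = 0 := dirDeriv_secantForm hα hp (hcard i) hf
  have hD (f : Polynomial K) (hf : f.natDegree ≤ 1) : dirDeriv (fun i => α i * f.eval (p i))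
      ((∏ i, F i) ^ t * (∏ i ∈ Q, F i) * H) = 0 := by
    have h1 (s : Finset ι) : dirDeriv (fun i => α i * f.eval (p i)) (∏ i ∈ s, F i) = 0 :=
       derivation_prod_eq_zero _ _ _ fun i _ => hFD i f hf
    rw [Derivation.leibniz, Derivation.leibniz, Derivation.leibniz_pow, h1, h1, hHD f hf]
    simp
  refine ⟨(∏ i, F i) ^ t * (∏ i ∈ Q, F i) * H, ?_, ?_, fun i => ?_, ?_, ?_⟩
  · exact mul_ne_zero (mul_ne_zero (pow_ne_zero _ (Finset.prod_ne_zero_iff.mpr fun i _ => hF0 i))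
      (Finset.prod_ne_zero_iff.mpr fun i _ => hF0 i)) hH0
  · have h1 := IsHomogeneous.prod Finset.univ F (fun _ => m) fun i _ => hFh i
    have h2 := IsHomogeneous.prod Q F (fun _ => m) fun i _ => hFh i
    convert ((h1.pow t).mul h2).mul hHh using 1
    simp only [Finset.sum_const, Finset.card_univ, hι, hQ, smul_eq_mul]
    ring
  · have h1 (s : Finset ι) : degreeOf i (∏ j ∈ s, F j) + (if i ∈ s then 1 else 0) ≤ s.card := by
      have h2 := (degreeOf_prod_le i s F).trans (Finset.sum_le_sum fun j _ => hFd i j)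
      have h3 : ∑ j ∈ s, (if i = j then 0 else 1) + (if i ∈ s then 1 else 0) = s.card := by
        rw [← Finset.sum_ite_eq s i fun _ => 1, ← Finset.sum_add_distrib, Finset.card_eq_sum_ones]
        exact Finset.sum_congr rfl fun j _ => by split_ifs <;> rfl
      omega
    have h4 := h1 Finset.univ
    rw [if_pos (Finset.mem_univ i), Finset.card_univ, hι] at h4
    have h5 := h1 Q
    have h6 := hHd i
    have h7 := degreeOf_mul_le i ((∏ i, F i) ^ t * (∏ i ∈ Q, F i)) H
    have h8 := degreeOf_mul_le i ((∏ i, F i) ^ t) (∏ i ∈ Q, F i)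
    have h9 := degreeOf_pow_le i (∏ i, F i) t
    have h10 : t * degreeOf i (∏ i, F i) ≤ t * (2 * m + 1) := Nat.mul_le_mul_left _ (by omega)
    rw [mul_comm (2 * m + 1) t]
    omega
  · simpa using hD 1 (by simp)
  · simpa using hD Polynomial.X (by simp)

end SecantForm

/-! ### Macaulay's inverse systems. -/

section Apolarity

variable {ι K : Type*} [Fintype ι] [Field K]

/-- The contraction pairing with `G`: the value of `f(∂) G` at the origin. -/
def apolar (G : MvPolynomial ι K) : MvPolynomial ι K →ₗ[K] K :=
  (basisMonomials ι K).constr K fun γ => ((∏ i, (γ i).factorial : ℕ) : K) * coeff γ G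

lemma apolar_monomial (G : MvPolynomial ι K) (γ : ι →₀ ℕ) (c : K) :
    apolar G (monomial γ c) = c * (((∏ i, (γ i).factorial : ℕ) : K) * coeff γ G) := by
  have h : monomial γ c = c • basisMonomials ι K γ := by
    rw [coe_basisMonomials, smul_monomial, smul_eq_mul, mul_one]
  rw [h, map_smul, apolar, Module.Basis.constr_basis, smul_eq_mul]

/-- The factorials in the pairing are there for this adjointness. -/
lemma apolar_X_mul (G : MvPolynomial ι K) (i : ι) (f : MvPolynomial ι K) :
    apolar G (X i * f) = apolar (pderiv i G) f := by
  classical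
  induction f using MvPolynomial.induction_on' with
  | monomial γ c =>
    have h : X i * monomial γ c = monomial (γ + Finsupp.single i 1) c := by
      rw [X, monomial_mul, one_mul, add_comm]
    have h2 : ∏ j, ((γ + Finsupp.single i 1 : ι →₀ ℕ) j).factorial
        = (γ i + 1) * ∏ j, (γ j).factorial := by
      rw [← Finset.mul_prod_erase _ _ (Finset.mem_univ i),
        ← Finset.mul_prod_erase _ (fun j => (γ j).factorial) (Finset.mem_univ i)]
      simp only [Finsupp.add_apply, Finsupp.single_eq_same, Nat.factorial_succ, mul_assoc]
      congr 2
      refine Finset.prod_congr rfl fun j hj => ?_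
      rw [Finsupp.single_eq_of_ne (Finset.ne_of_mem_erase hj), add_zero]
    rw [h, apolar_monomial, apolar_monomial, coeff_pderiv, h2]
    push_cast
    ring
  | add f g hf hg => rw [mul_add, map_add, map_add, hf, hg]

lemma apolar_dirDeriv (G : MvPolynomial ι K) (β : ι → K) (f : MvPolynomial ι K) :
    apolar G ((∑ i, C (β i) * X i) * f) = apolar (dirDeriv β G) f := by
  have h : apolar (dirDeriv β G) = ∑ i, β i • apolar (pderiv i G) := by
    refine (basisMonomials ι K).ext fun γ => ?_
    simp only [coe_basisMonomials, apolar_monomial, dirDeriv_apply, LinearMap.sum_apply,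
      LinearMap.smul_apply, coeff_sum, coeff_smul, smul_eq_mul, Finset.mul_sum]
    exact Finset.sum_congr rfl fun i _ => by ring
  rw [h, Finset.sum_mul, map_sum, LinearMap.sum_apply]
  refine Finset.sum_congr rfl fun i _ => ?_
  rw [mul_assoc, ← smul_eq_C_mul, map_smul, apolar_X_mul, LinearMap.smul_apply]

lemma apolar_zero_left (f : MvPolynomial ι K) : apolar 0 f = 0 := by
  simpa using (apolar_dirDeriv 0 (0 : ι → K) f).symm

lemma apolar_X_pow_mul {G : MvPolynomial ι K} {i : ι} {d : ℕ} (hG : degreeOf i G < d)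
    (f : MvPolynomial ι K) : apolar G (X i ^ d * f) = 0 := by
  classical
  induction f using MvPolynomial.induction_on' with
  | monomial γ c =>
    rw [X_pow_eq_monomial, monomial_mul, apolar_monomial]
    have h : coeff (Finsupp.single i d + γ) G = 0 := by
      by_contra h
      have := monomial_le_degreeOf i (mem_support_iff.mpr h)
      simp at this
      omega
    rw [h, mul_zero, mul_zero]
  | add f g hf hg => rw [mul_add, map_add, hf, hg, add_zero]

/-- The annihilator of `G` under differentiation. -/
def apolarIdeal (G : MvPolynomial ι K) : Ideal (MvPolynomial ι K) where
  carrier := {f | ∀ w, apolar G (f * w) = 0}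
  add_mem' hf hg w := by rw [add_mul, map_add, hf w, hg w, add_zero]
  zero_mem' w := by rw [zero_mul, map_zero]
  smul_mem' c f hf w := by
    rw [smul_eq_mul, mul_comm c f, mul_assoc]
    exact hf _

lemma mem_apolarIdeal {G f : MvPolynomial ι K} :
    f ∈ apolarIdeal G ↔ ∀ w, apolar G (f * w) = 0 := Iff.rfl

lemma monomial_notMem_apolarIdeal [CharZero K] {G : MvPolynomial ι K} {γ : ι →₀ ℕ}
    (hγ : γ ∈ G.support) : monomial γ 1 ∉ apolarIdeal G := by
  intro h
  have h1 := mem_apolarIdeal.mp h 1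
  rw [mul_one, apolar_monomial, one_mul] at h1
  refine mul_ne_zero ?_ (mem_support_iff.mp hγ) h1
  exact_mod_cast Finset.prod_ne_zero_iff.mpr fun i _ => Nat.factorial_ne_zero _

end Apolarity

/-! ### From an invariant form to a nonzero cokernel. -/

section Cokernel

variable {K : Type*} [Field K] {n : ℕ}

/-- The coefficients of the two linear relations, in terms of the linear form `L`. -/
def extendCoeff (a : Fin (n + 1) → K) (o : Option (Fin (n + 1))) : K := o.elim (-1) a

/-- The ratios of the coefficients of `b` and `a`, extended by `0`. -/
def extendRatio (a b : Fin (n + 1) → K) (o : Option (Fin (n + 1))) : K :=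
  o.elim 0 fun i => b i / a i

/-- The variable `X none` stands for `L`: invariance of `G` along `extendCoeff a` identifies the two
modulo the annihilator of `G`. -/
lemma linear_extendCoeff (a : Fin (n + 1) → K) :
    ∑ o, C (extendCoeff a o) * X o = rename some (linearForm a) - X none := by
  simp [Fintype.sum_option, extendCoeff, linearForm]
  ring

lemma linear_extendRatio {a : Fin (n + 1) → K} (ha : ∀ i, a i ≠ 0) (b : Fin (n + 1) → K) :
    ∑ o, C (extendCoeff a o * extendRatio a b o) * X o = rename some (linearForm b) := by
  rw [Fintype.sum_option, linearForm, map_sum]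
  simp only [extendCoeff, extendRatio, Option.elim_none, Option.elim_some, mul_zero, C_0, zero_mul,
    zero_add, map_mul, rename_C, rename_X]
  refine Finset.sum_congr rfl fun i _ => ?_
  rw [← C_mul, mul_div_cancel₀ _ (ha i)]

/-- The algebra `K[x_0, …, x_n]/(x_0 ^ d, …, x_n ^ d, L ^ d, ℓ)` is not zero in degree `j` if there
is a nonzero form of degree `j` in the inverse system. -/
theorem exists_forall_sub_mul_notMem [CharZero K] {a b : Fin (n + 1) → K} (ha : ∀ i, a i ≠ 0)
    {d j : ℕ} {G : MvPolynomial (Option (Fin (n + 1))) K} (hG : G ≠ 0) (hGj : G.IsHomogeneous j)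
    (hGd : ∀ o, degreeOf o G < d) (h1 : dirDeriv (extendCoeff a) G = 0)
    (h2 : dirDeriv (fun o => extendCoeff a o * extendRatio a b o) G = 0) :
    ∃ f : MvPolynomial (Fin (n + 1)) K, f.IsHomogeneous j ∧
      ∀ g, f - linearForm b * g ∉ powerIdeal (linearForm a) d := by
  obtain ⟨γ, hγ⟩ := support_nonempty.mpr hG
  have hL : rename some (linearForm a) - X none ∈ apolarIdeal G := fun w => by
    rw [← linear_extendCoeff, apolar_dirDeriv, h1, apolar_zero_left]
  have hℓ : rename some (linearForm b) ∈ apolarIdeal G := fun w => by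
    rw [← linear_extendRatio ha, apolar_dirDeriv, h2, apolar_zero_left]
  have hX (o : Option (Fin (n + 1))) : X o ^ d ∈ apolarIdeal G := apolar_X_pow_mul (hGd o)
  have hpow (k : ℕ) : rename some (linearForm a) ^ k - X none ^ k ∈ apolarIdeal G :=
    Ideal.mem_of_dvd _ (sub_dvd_pow_sub_pow _ _ _) hL
  have hI : powerIdeal (linearForm a) d ≤
      (apolarIdeal G).comap (rename some : MvPolynomial (Fin (n + 1)) K →ₐ[K] _) := by
    refine Ideal.span_le.mpr ?_
    rintro _ (⟨i, rfl⟩ | rfl)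
    · simpa using hX (some i)
    · have := add_mem (hpow d) (hX none)
      simpa using this
  -- The witness is a monomial of the support of `G` with `L` substituted for `X none`; modulo the
  -- annihilator of `G` it equals that monomial, which is not zero there.
  refine ⟨(∏ i, X i ^ γ (some i)) * linearForm a ^ γ none, ?_, fun g hg => ?_⟩
  · have h3 := (IsHomogeneous.prod Finset.univ (fun i => (X i : MvPolynomial (Fin (n + 1)) K) ^
      γ (some i)) (fun i => γ (some i)) fun i _ => isHomogeneous_X_pow i _).mul
      (linearForm_pow_isHomogeneous a (γ none))
    convert h3 using 1
    have h4 : γ.degree = j := by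
      by_contra h
      exact mem_support_iff.mp hγ (hGj.coeff_eq_zero h)
    rw [← h4, Finsupp.degree_eq_sum, Fintype.sum_option, add_comm]
  · have h3 := hI hg
    rw [Ideal.mem_comap, map_sub, map_mul] at h3
    have h4 := add_mem h3 (Ideal.mul_mem_right (rename some g) _ hℓ)
    have h5 := sub_mem h4
      (Ideal.mul_mem_left _ (∏ i, X (some i) ^ γ (some i)) (hpow (γ none)))
    refine monomial_notMem_apolarIdeal hγ ?_
    convert h5 using 1
    rw [monomial_eq, C_1, one_mul, Finsupp.prod_fintype _ _ (by simp), Fintype.prod_option]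
    simp only [map_mul, map_prod, map_pow, rename_X]
    ring

end Cokernel

/-! ### Openness of surjectivity along a line. -/

section Semicontinuity

variable {K : Type*} [Field K]

/-- If `M₀` is surjective, then so is `M₀ + s M₁` for all but finitely many `s`. -/
lemma finite_not_surjective_add_smul {V W : Type*} [AddCommGroup V] [Module K V]
    [AddCommGroup W] [Module K W] [FiniteDimensional K W] (M₀ M₁ : V →ₗ[K] W)
    (h : Function.Surjective M₀) :
    {s : K | ¬ Function.Surjective (M₀ + s • M₁)}.Finite := by
  obtain ⟨N, hN⟩ := M₀.exists_rightInverse_of_surjective (LinearMap.range_eq_top.mpr h)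
  -- `(M₀ + s • M₁) ∘ N = 1 + s • (M₁ ∘ N)` can be non-injective only if `-s⁻¹` is an eigenvalue of
  -- `M₁ ∘ N`.
  have hfin := (Module.End.finite_hasEigenvalue (M₁ ∘ₗ N)).image fun μ => -μ⁻¹
  refine hfin.subset fun s hs => ?_
  by_contra hs'
  refine hs ?_
  have hinj : Function.Injective ((M₀ + s • M₁) ∘ₗ N) := by
    rw [← LinearMap.ker_eq_bot, LinearMap.ker_eq_bot']
    intro w hw
    have h1 : M₀ (N w) = w := LinearMap.congr_fun hN w
    simp only [LinearMap.comp_apply, LinearMap.add_apply, LinearMap.smul_apply, h1] at hw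
    by_contra hw0
    have hs0 : s ≠ 0 := by
      rintro rfl
      simp at hw
      exact hw0 hw
    refine hs' ⟨-s⁻¹, ?_, by simp⟩
    refine Module.End.hasEigenvalue_of_hasEigenvector (x := w)
      ⟨Module.End.mem_eigenspace_iff.mpr ?_, hw0⟩
    have h2 : s • M₁ (N w) = -w := (neg_eq_of_add_eq_zero_right hw).symm
    rw [LinearMap.comp_apply, neg_smul, ← smul_neg, ← h2, smul_smul, inv_mul_cancel₀ hs0,
      one_smul]
  have hsurj := LinearMap.injective_iff_surjective.mp hinj
  exact Function.Surjective.of_comp (g := N) hsurj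

end Semicontinuity

/-! ### Failure of the weak Lefschetz property in the critical degree. -/

section Failure

variable {K : Type*} [Field K] {n : ℕ}

instance {σ : Type*} [Fintype σ] (I : Ideal (MvPolynomial σ K)) (j : ℕ) :
    FiniteDimensional K (gradedPiece I j) := by
  unfold gradedPiece
  infer_instance

lemma linearForm_add_smul (b c : Fin (n + 1) → K) (s : K) :
    linearForm (b + s • c) = linearForm b + s • linearForm c := by
  simp only [linearForm, smul_eq_C_mul, Finset.mul_sum, ← Finset.sum_add_distrib]
  refine Finset.sum_congr rfl fun i _ => ?_
  simp only [Pi.add_apply, Pi.smul_apply, smul_eq_mul, map_add, map_mul]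
  ring

lemma exists_linearForm_eq {ℓ : MvPolynomial (Fin (n + 1)) K}
    (hℓ : ℓ ∈ homogeneousSubmodule (Fin (n + 1)) K 1) : ∃ b, ℓ = linearForm b := by
  rw [homogeneousSubmodule_one_eq_span_X, Submodule.mem_span_range_iff_exists_fun] at hℓ
  obtain ⟨b, hb⟩ := hℓ
  exact ⟨b, by rw [← hb, linearForm]; simp only [smul_eq_C_mul]⟩

lemma linearForm_mul_mem_gradedPiece (I : Ideal (MvPolynomial (Fin (n + 1)) K)) (j : ℕ)
    (b : Fin (n + 1) → K) {x : MvPolynomial (Fin (n + 1)) K ⧸ I} (hx : x ∈ gradedPiece I j) :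
    Ideal.Quotient.mk I (linearForm b) * x ∈ gradedPiece I (j + 1) := by
  obtain ⟨f, hf, rfl⟩ := hx
  refine ⟨linearForm b * f, ?_, map_mul (Ideal.Quotient.mk I) _ _⟩
  rw [add_comm j]
  exact (linear_isHomogeneous b).mul hf

/-- The multiplication by a linear form, as a map between graded pieces. -/
def mulLinearForm (I : Ideal (MvPolynomial (Fin (n + 1)) K)) (j : ℕ) (b : Fin (n + 1) → K) :
    gradedPiece I j →ₗ[K] gradedPiece I (j + 1) :=
  (LinearMap.mulLeft K (Ideal.Quotient.mk I (linearForm b))).restrict fun _ hx =>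
    linearForm_mul_mem_gradedPiece I j b hx

lemma coe_mulLinearForm (I : Ideal (MvPolynomial (Fin (n + 1)) K)) (j : ℕ) (b : Fin (n + 1) → K)
    (x : gradedPiece I j) :
    (mulLinearForm I j b x : MvPolynomial (Fin (n + 1)) K ⧸ I)
      = Ideal.Quotient.mk I (linearForm b) * x := rfl

lemma mulLinearForm_add_smul (I : Ideal (MvPolynomial (Fin (n + 1)) K)) (j : ℕ)
    (b c : Fin (n + 1) → K) (s : K) :
    mulLinearForm I j (b + s • c) = mulLinearForm I j b + s • mulLinearForm I j c := by
  refine LinearMap.ext fun x => Subtype.ext ?_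
  rw [LinearMap.add_apply, LinearMap.smul_apply, Submodule.coe_add, Submodule.coe_smul,
    coe_mulLinearForm, coe_mulLinearForm, coe_mulLinearForm, linearForm_add_smul, map_add, add_mul,
    ← smul_mul_assoc]
  rfl

/-- The ratio at `some i` moves with speed `i + 1` and the one at `none` stays at `0`. The speeds
are distinct in characteristic zero, so each pair of ratios collides for at most one `s`. -/
lemma finite_not_injective_extendRatio [CharZero K] {a : Fin (n + 1) → K} (ha : ∀ i, a i ≠ 0)
    (b : Fin (n + 1) → K) :
    {s : K | ¬ Function.Injective
      (extendRatio a (b + s • fun i => a i * ((i : ℕ) + 1)))}.Finite := by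
  let e : Option (Fin (n + 1)) → K := fun o => o.elim 0 fun i => ((i : ℕ) + 1)
  have he : Function.Injective e := by
    rintro (_ | i) (_ | k) h
    · rfl
    · exact absurd h.symm (Nat.cast_add_one_ne_zero (R := K) k)
    · exact absurd h (Nat.cast_add_one_ne_zero (R := K) i)
    · simp only [e, Option.elim, add_left_inj, Nat.cast_inj] at h
      rw [Fin.ext h]
  have hr (s : K) (o : Option (Fin (n + 1))) :
      extendRatio a (b + s • fun i => a i * ((i : ℕ) + 1)) o = extendRatio a b o + s * e o := by
    rcases o with _ | i
    · simp [extendRatio, e]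
    · have := ha i
      simp only [extendRatio, e, Option.elim, Pi.add_apply, Pi.smul_apply, smul_eq_mul]
      field_simp
  refine (Set.finite_range fun x : Option (Fin (n + 1)) × Option (Fin (n + 1)) =>
    (extendRatio a b x.2 - extendRatio a b x.1) / (e x.1 - e x.2)).subset fun s hs => ?_
  simp only [Set.mem_ofPred_eq, Function.Injective, not_forall] at hs
  obtain ⟨o, o', h, hne⟩ := hs
  refine ⟨(o, o'), ?_⟩
  rw [hr, hr] at h
  rw [div_eq_iff (sub_ne_zero.mpr fun h' => hne (he h'))]
  linear_combination -h

lemma surjective_mulLinearForm_of_finrank_le {I : Ideal (MvPolynomial (Fin (n + 1)) K)} {j : ℕ}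
    {b : Fin (n + 1) → K}
    (hI : Module.finrank K (gradedPiece I (j + 1)) ≤ Module.finrank K (gradedPiece I j))
    (h : Set.InjOn (fun x => Ideal.Quotient.mk I (linearForm b) * x) (gradedPiece I j) ∨
      Set.SurjOn (fun x => Ideal.Quotient.mk I (linearForm b) * x) (gradedPiece I j)
        (gradedPiece I (j + 1))) :
    Function.Surjective (mulLinearForm I j b) := by
  rcases h with h | h
  · have hinj : Function.Injective (mulLinearForm I j b) := fun x y hxy =>
      Subtype.ext (h x.2 y.2 (congrArg Subtype.val hxy))
    exact (LinearMap.injective_iff_surjective_of_finrank_eq_finrank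
      ((LinearMap.finrank_le_finrank_of_injective hinj).antisymm hI)).mp hinj
  · intro y
    obtain ⟨x, hx, hxy⟩ := h y.2
    exact ⟨⟨x, hx⟩, Subtype.ext hxy⟩

/-- Failure of the weak Lefschetz property, given that the dimension does not grow in the critical
degree. -/
theorem not_hasWLP_of_finrank_le [CharZero K] {m q t j : ℕ} (hq : q ≤ 2 * m)
    {a : Fin (2 * m + 1) → K} (ha : ∀ i, a i ≠ 0)
    (hj : j + 1 = 2 * m * (m + 1) * t + m * q + m * q / (2 * m + 1))
    (hdim : Module.finrank K
        (gradedPiece (powerIdeal (linearForm a) ((2 * m + 1) * t + q + 1)) (j + 1))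
      ≤ Module.finrank K
        (gradedPiece (powerIdeal (linearForm a) ((2 * m + 1) * t + q + 1)) j)) :
    ¬ HasWLP (powerIdeal (linearForm a) ((2 * m + 1) * t + q + 1)) := by
  classical
  set I := powerIdeal (linearForm a) ((2 * m + 1) * t + q + 1) with hI
  rintro ⟨ℓ, hℓ, h⟩
  obtain ⟨b, rfl⟩ := exists_linearForm_eq hℓ
  have hsurj := surjective_mulLinearForm_of_finrank_le hdim (h j)
  -- Replace the given linear form by one that is still surjective in this degree and has distinct
  -- ratios.
  obtain ⟨s, hs⟩ := ((finite_not_surjective_add_smul _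
    (mulLinearForm I j fun i => a i * ((i : ℕ) + 1)) hsurj).union
      (finite_not_injective_extendRatio ha b)).infinite_compl.nonempty
  simp only [Set.compl_union, Set.mem_inter_iff, Set.mem_compl_iff, Set.mem_ofPred_eq,
    not_not] at hs
  obtain ⟨hs1, hs2⟩ := hs
  rw [← mulLinearForm_add_smul] at hs1
  obtain ⟨G, hG0, hGj, hGd, hG1, hG2⟩ := exists_invariant_form
    (ι := Option (Fin (2 * m + 1))) (m := m) (by simp) (α := extendCoeff a)
    (by rintro (_ | i)
        · simp [extendCoeff]
        · exact ha i) hs2 hq t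
  rw [← hj] at hGj
  obtain ⟨f, hf, hfg⟩ := exists_forall_sub_mul_notMem ha hG0 hGj
    (fun o => Nat.lt_succ_of_le (hGd o)) hG1 hG2
  obtain ⟨⟨_, g, hg, rfl⟩, hx⟩ := hs1 ⟨_, f, hf, rfl⟩
  refine hfg g (Ideal.Quotient.eq.mp ?_)
  rw [map_mul]
  exact (congrArg Subtype.val hx).symm

/-- All components of positive degree vanish, so even `ℓ = 0` is surjective. -/
lemma hasWLP_powerIdeal_one (L : MvPolynomial (Fin (n + 1)) K) : HasWLP (powerIdeal L 1) := by
  refine ⟨0, zero_mem _, fun j => Or.inr ?_⟩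
  rintro _ ⟨f, hf, rfl⟩
  refine ⟨0, zero_mem _, ?_⟩
  have h : f ∈ powerIdeal L 1 := by
    refine monomialIdeal_le_powerIdeal 1 L (mem_monomialIdeal_iff.mpr fun γ hγ => ?_)
    by_contra h
    push Not at h
    refine mem_support_iff.mp hγ (IsHomogeneous.coeff_eq_zero hf ?_)
    rw [Finsupp.degree_eq_sum, Finset.sum_eq_zero fun i _ => Nat.lt_one_iff.mp (h i)]
    omega
  simpa using (Ideal.Quotient.eq_zero_iff_mem.mpr h).symm

lemma failureConjecture_one (n : ℕ) : FailureConjecture.{u} n 1 := fun K _ _ =>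
  ⟨1, one_ne_zero, fun a _ => by simp [hasWLP_powerIdeal_one]⟩

lemma failureConjecture_of_forall {d : ℕ} (hd : 1 < d)
    (h : ∀ (K : Type u) [Field K] [CharZero K] (a : Fin (n + 1) → K), (∀ i, a i ≠ 0) →
      ¬ HasWLP (powerIdeal (linearForm a) d)) : FailureConjecture.{u} n d := fun K _ _ =>
  ⟨∏ i, X i, Finset.prod_ne_zero_iff.mpr fun i _ => X_ne_zero i, fun a ha => by
    rw [map_prod, Finset.prod_ne_zero_iff] at ha
    exact iff_of_true (h K a fun i => by simpa using ha i (Finset.mem_univ i)) hd⟩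

end Failure

end Algebra

/-! ### Counting monomials by generating functions. -/

section Count

open PowerSeries

lemma coeff_geom_pow (σ : Type*) [Fintype σ] (d j : ℕ) :
    coeff j ((∑ i ∈ Finset.range d, (X : ℤ⟦X⟧) ^ i) ^ Fintype.card σ)
      = (boundedExponents σ d j).card := by
  classical
  rw [← Finset.card_univ, ← Finset.prod_const,
    Finset.prod_univ_sum (fun _ : σ => Finset.range d) fun _ i => (X : ℤ⟦X⟧) ^ i, map_sum]
  simp only [Finset.prod_pow_eq_pow_sum, coeff_X_pow]
  rw [boundedExponents, Finset.card_filter]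
  push_cast
  exact Finset.sum_congr rfl fun γ _ => by simp only [eq_comm]

/-- Both sides are `(1 - X ^ d) ^ (2 * m + 4) / (1 - X) ^ (2 * m + 2)`. It is applied with `m - 1`
for `m`, so that `2 * m + 3` becomes the number of variables `x_i`. -/
lemma one_sub_X_pow_mul_eq (m d : ℕ) :
    (1 - X) * (1 - X ^ d) * (∑ i ∈ Finset.range d, (X : ℤ⟦X⟧) ^ i) ^ (2 * m + 3)
      = (1 - X ^ d) ^ (2 * m + 4) * mk fun i => (((2 * m + 1 + i).choose (2 * m + 1) : ℕ) : ℤ) := by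
  have h1 := mul_neg_geom_sum (X : ℤ⟦X⟧) d
  have h2 := mk_add_choose_mul_one_sub_pow_eq_one ℤ (2 * m + 1)
  have h3 : (1 - X : ℤ⟦X⟧) ^ (2 * m + 3) * (∑ i ∈ Finset.range d, (X : ℤ⟦X⟧) ^ i) ^ (2 * m + 3)
      = (1 - X ^ d) ^ (2 * m + 3) := by
    rw [← mul_pow, h1]
  generalize (mk fun i => (((2 * m + 1 + i).choose (2 * m + 1) : ℕ) : ℤ)) = B at *
  generalize (∑ i ∈ Finset.range d, (X : ℤ⟦X⟧) ^ i) ^ (2 * m + 3) = A at *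
  linear_combination (-((1 - X) * (1 - X ^ d) * A)) * h2 + ((1 - X ^ d) * B) * h3

lemma one_sub_X_pow_pow (d N : ℕ) :
    (1 - (X : ℤ⟦X⟧) ^ d) ^ N
      = ∑ k ∈ Finset.range (N + 1), C ((-1) ^ k * (N.choose k : ℤ)) * X ^ (d * k) := by
  rw [sub_eq_neg_add, add_pow]
  refine Finset.sum_congr rfl fun k _ => ?_
  rw [neg_pow, one_pow, pow_mul]
  simp only [map_mul, map_pow, map_neg, map_one, map_natCast]
  ring

/-- The values of `P` at natural numbers are the differences of the Hilbert function that are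
expected in the critical degree. -/
lemma P_natCast_eq_card {m q t d j : ℕ} (hm : 2 ≤ m) (hq : q ≤ 2 * m)
    (hd : d = (2 * m + 1) * t + q + 1)
    (hj : j + 1 = 2 * m * (m + 1) * t + m * q + m * q / (2 * m + 1)) :
    P m q t = ((((boundedExponents (Fin (2 * m + 1)) d (j + 1)).card : ℤ)
        - (boundedExponents (Fin (2 * m + 1)) d j).card
        - (if d ≤ j + 1 then ((boundedExponents (Fin (2 * m + 1)) d (j + 1 - d)).card : ℤ) else 0)
        + (if d ≤ j then ((boundedExponents (Fin (2 * m + 1)) d (j - d)).card : ℤ) else 0) : ℤ)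
          : ℝ) := by
  set e := m * q / (2 * m + 1) with he
  have heq : e ≤ q := by
    have h1 : e * (2 * m + 1) ≤ m * q := Nat.div_mul_le_self _ _
    by_contra h
    push Not at h
    nlinarith
  obtain ⟨m', rfl⟩ : ∃ m', m = m' + 1 := ⟨m - 1, by omega⟩
  have h1 := congrArg (coeff (j + 1)) (one_sub_X_pow_mul_eq m' d)
  have hcard := coeff_geom_pow (Fin (2 * (m' + 1) + 1)) d
  rw [Fintype.card_fin] at hcard
  have hl (A : ℤ⟦X⟧) : coeff (j + 1) ((1 - X) * (1 - X ^ d) * A)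
      = coeff (j + 1) A - coeff j A - (if d ≤ j + 1 then coeff (j + 1 - d) A else 0)
        + (if d ≤ j then coeff (j - d) A else 0) := by
    have : (1 - X) * (1 - X ^ d) * A = A - A * X - A * X ^ d + (A * X ^ d) * X := by ring
    rw [this, map_add, map_sub, map_sub, coeff_succ_mul_X, coeff_succ_mul_X, coeff_mul_X_pow',
      coeff_mul_X_pow']
  have hN : 2 * m' + 3 = 2 * (m' + 1) + 1 := by ring
  rw [hl, hN, hcard, hcard, hcard, hcard] at h1
  rw [h1, one_sub_X_pow_pow, Finset.sum_mul, map_sum, P]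
  push_cast
  have hsub : Finset.range (m' + 1 + 1) ⊆ Finset.range (2 * m' + 4 + 1) := by
    intro k
    simp only [Finset.mem_range]
    omega
  rw [← Finset.sum_subset hsub]
  · refine Finset.sum_congr rfl fun k hk => ?_
    have hkm : k ≤ m' + 1 := by
      simp only [Finset.mem_range] at hk
      omega
    -- The upper entry of the binomial coefficient is therefore a natural number, where
    -- `Ring.choose` agrees with `Nat.choose`.
    have hdk : d * k ≤ j + 1 + (2 * m' + 1) := by
      have : d * k ≤ d * (m' + 1) := Nat.mul_le_mul_left _ hkm
      rw [hd] at this ⊢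
      nlinarith [Nat.zero_le t, Nat.zero_le (m' * t)]
    obtain ⟨x, hx⟩ := Nat.exists_eq_add_of_le hdk
    have hxr : (((m' + 1 : ℕ) : ℝ) - 1 + (e : ℝ) + (q + 1) * (((m' + 1 : ℕ) : ℝ) - k)
        + t * (2 * ((m' + 1 : ℕ) : ℝ) * (((m' + 1 : ℕ) : ℝ) + 1)
          - k * (2 * ((m' + 1 : ℕ) : ℝ) + 1))) = (x : ℝ) := by
      have h2 : ((j + 1 + (2 * m' + 1) : ℕ) : ℝ) = ((d * k + x : ℕ) : ℝ) := congrArg _ hx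
      rw [hj, hd] at h2
      push_cast at h2 ⊢
      linear_combination h2
    push_cast at hxr
    rw [hxr, Ring.choose_natCast, mul_assoc (C _), coeff_C_mul, coeff_X_pow_mul']
    have h3 : 2 * (m' + 1) - 1 = 2 * m' + 1 := by omega
    rw [h3, show 2 * (m' + 1) + 2 = 2 * m' + 4 by ring]
    split_ifs with h4
    · rw [coeff_mk, show 2 * m' + 1 + (j + 1 - d * k) = x by omega]
      push_cast
      ring
    -- For `d * k > j + 1` the power series contributes nothing, and the binomial coefficient
    -- vanishes too.
    · rw [Nat.choose_eq_zero_of_lt (show x < 2 * m' + 1 by omega)]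
      simp
  · intro k _ hk
    have hkm : m' + 1 + 1 ≤ k := by simpa using hk
    rw [mul_assoc, coeff_C_mul, coeff_X_pow_mul', if_neg, mul_zero, Int.cast_zero]
    have : d * (m' + 1 + 1) ≤ d * k := Nat.mul_le_mul_left _ hkm
    rw [hd] at this ⊢
    nlinarith [Nat.zero_le t, Nat.zero_le (m' * t)]

/-- The conjecture holds for `d > 1` if the Hilbert function of the almost complete intersection
does not increase in the critical degree. -/
theorem failureConjecture_of_P_nonpos {m q t d : ℕ} (hm : 2 ≤ m) (hq : q ≤ 2 * m)
    (hd : d = (2 * m + 1) * t + q + 1) (hd1 : 1 < d) (hP : P m q t ≤ 0) :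
    FailureConjecture.{u} (2 * m) d := by
  set e := m * q / (2 * m + 1) with he
  have heq : 2 * e ≤ q := by
    have h1 : e * (2 * m + 1) ≤ m * q := Nat.div_mul_le_self _ _
    by_contra h
    push Not at h
    nlinarith
  have hdj : d ≤ 2 * m * (m + 1) * t + m * q + e := by
    rcases Nat.eq_zero_or_pos q with rfl | h
    · have : 1 ≤ t := by
        by_contra h
        push Not at h
        simp only [Nat.lt_one_iff.mp h] at hd
        omega
      subst hd
      nlinarith [Nat.mul_le_mul hm hm, Nat.mul_le_mul hm this]
    · subst hd
      have h1 : q + 1 ≤ m * q := by nlinarith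
      have h2 : (2 * m + 1) * t ≤ 2 * m * (m + 1) * t := Nat.mul_le_mul_right _ (by nlinarith)
      omega
  obtain ⟨j, hj⟩ : ∃ j, j + 1 = 2 * m * (m + 1) * t + m * q + e :=
    ⟨2 * m * (m + 1) * t + m * q + e - 1, by omega⟩
  rw [P_natCast_eq_card hm hq hd hj] at hP
  rw [if_pos (hj ▸ hdj)] at hP
  have hP' := Int.cast_nonpos.mp hP
  refine failureConjecture_of_forall hd1 fun K _ _ a ha => ?_
  have hdim : Module.finrank K (gradedPiece (powerIdeal (linearForm a) d) (j + 1))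
      ≤ Module.finrank K (gradedPiece (powerIdeal (linearForm a) d) j) := by
    refine finrank_gradedPiece_succ_le d ha hd1.le (hj ▸ hdj) ?_ ?_
    -- This bound puts the multiplication by `L ^ d` into degree `j + 1` within the injective range
    -- of the strong Lefschetz property.
    · have h1 : 2 * (j + 1) ≤ (2 * m + 2) * (d - 1) := by
        rw [hj, hd, Nat.add_sub_cancel]
        nlinarith
      have h2 : (2 * m + 2) * (d - 1) = (2 * m + 1) * (d - 1) + (d - 1) := by ring
      omega
    · split_ifs at hP' ⊢ <;> omega
  subst hd
  exact not_hasWLP_of_finrank_le hq ha hj hdim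

end Count

/-! ### Concavity of the uniform-sum density near its mean. -/

section Spline

open intervalIntegral MeasureTheory

lemma alternating_sum_choose_succ (n : ℕ) (h : ℕ → ℝ) :
    ∑ k ∈ Finset.range (n + 2), (-1) ^ k * ((n + 1).choose k : ℝ) * h k
      = ∑ k ∈ Finset.range (n + 1), (-1) ^ k * (n.choose k : ℝ) * (h k - h (k + 1)) := by
  have h1 : ∑ k ∈ Finset.range (n + 1), (-1) ^ k * (n.choose k : ℝ) * h k
      = ∑ k ∈ Finset.range (n + 2), (-1) ^ k * (n.choose k : ℝ) * h k := by
    rw [Finset.sum_range_succ _ (n + 1)]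
    simp
  simp only [mul_sub, Finset.sum_sub_distrib]
  rw [h1, Finset.sum_range_succ', Finset.sum_range_succ' _ (n + 1)]
  simp only [Nat.choose_succ_succ]
  push_cast
  simp only [mul_add, add_mul, Finset.sum_add_distrib]
  have h2 (k : ℕ) : (-1 : ℝ) ^ (k + 1) * (n.choose k : ℝ) * h (k + 1)
      = -((-1) ^ k * (n.choose k : ℝ) * h (k + 1)) := by ring
  simp only [h2, Finset.sum_neg_distrib]
  simp
  ring

/-- Up to the factor `p!`, the derivative of the density of the sum of `p + 2` independent random
variables that are uniformly distributed on `[0, 1]`. -/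
def splineDeriv (p : ℕ) (x : ℝ) : ℝ :=
  ∑ k ∈ Finset.range (p + 3), (-1) ^ k * ((p + 2).choose k : ℝ) * max (x - k) 0 ^ p

lemma continuous_splineDeriv (p : ℕ) : Continuous (splineDeriv p) := by
  unfold splineDeriv
  fun_prop

lemma integral_max_pow (p : ℕ) (z a b : ℝ) :
    ∫ y in a..b, max (y - z) 0 ^ (p + 1)
      = (max (b - z) 0 ^ (p + 2) - max (a - z) 0 ^ (p + 2)) / (p + 2) := by
  have h := integral_eq_of_hasDerivAt_off_countable
    (fun y : ℝ => max (y - z) 0 ^ (p + 2) / (p + 2)) (fun y => max (y - z) 0 ^ (p + 1))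
    (a := a) (b := b) (Set.countable_singleton z) (by fun_prop) ?_
    (Continuous.intervalIntegrable (by fun_prop) _ _)
  · rw [h]
    ring
  · rintro y ⟨-, hy⟩
    rcases lt_or_gt_of_ne hy with hy | hy
    · have h1 : (fun y : ℝ => max (y - z) 0 ^ (p + 2) / (p + 2)) =ᶠ[nhds y] fun _ => 0 := by
        filter_upwards [Iio_mem_nhds hy] with w hw
        rw [max_eq_right (by simp only [Set.mem_Iio] at hw; linarith)]
        simp
      rw [max_eq_right (by linarith), zero_pow (by omega)]
      exact (hasDerivAt_const y (0 : ℝ)).congr_of_eventuallyEq h1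
    · have h1 : (fun y : ℝ => max (y - z) 0 ^ (p + 2) / (p + 2)) =ᶠ[nhds y]
          fun y => (y - z) ^ (p + 2) / (p + 2) := by
        filter_upwards [Ioi_mem_nhds hy] with w hw
        rw [max_eq_left (by simp only [Set.mem_Ioi] at hw; linarith)]
      rw [max_eq_left (sub_nonneg.mpr hy.le)]
      refine HasDerivAt.congr_of_eventuallyEq ?_ h1
      have h2 := (((hasDerivAt_id y).sub_const z).pow (p + 2)).div_const ((p : ℝ) + 2)
      refine h2.congr_deriv ?_
      have h3 : (p : ℝ) + 2 ≠ 0 := by positivity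
      simp only [id]
      push_cast
      field_simp

/-- Adding one more uniform variable averages the density, hence its derivative, over a window of
length one. -/
lemma splineDeriv_succ (p : ℕ) (x : ℝ) :
    splineDeriv (p + 2) x = (p + 2) * ∫ y in (x - 1)..x, splineDeriv (p + 1) y := by
  unfold splineDeriv
  rw [integral_finsetSum fun k _ => Continuous.intervalIntegrable (by fun_prop) _ _,
    Finset.mul_sum]
  simp only [intervalIntegral.integral_const_mul]
  rw [alternating_sum_choose_succ (p + 3) fun k => max (x - k) 0 ^ (p + 2)]
  refine Finset.sum_congr rfl fun k _ => ?_
  have h := integral_max_pow p k (x - 1) x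
  rw [h]
  have h3 : (p : ℝ) + 2 ≠ 0 := by positivity
  have h4 : x - 1 - k = x - ((k + 1 : ℕ) : ℝ) := by push_cast; ring
  rw [h4]
  field_simp

/-- The antisymmetrization of `splineDeriv p` at distance `c` from its center `p / 2 + 1`. -/
def splineSkew (c : ℝ) (p : ℕ) (s : ℝ) : ℝ :=
  splineDeriv p ((p : ℝ) / 2 + 1 - c - s) - splineDeriv p ((p : ℝ) / 2 + 1 - c + s)

lemma continuous_splineSkew (c : ℝ) (p : ℕ) : Continuous (splineSkew c p) := by
  have := continuous_splineDeriv p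
  unfold splineSkew
  fun_prop

lemma splineSkew_neg (c : ℝ) (p : ℕ) (s : ℝ) : splineSkew c p (-s) = -splineSkew c p s := by
  simp only [splineSkew, sub_neg_eq_add, ← sub_eq_add_neg]
  ring

lemma splineSkew_succ (c : ℝ) (p : ℕ) (s : ℝ) :
    splineSkew c (p + 2) s
      = (p + 2) * ∫ u in (s - 1 / 2)..(s + 1 / 2), splineSkew c (p + 1) u := by
  have hc := continuous_splineDeriv (p + 1)
  have h1 := integral_comp_sub_left (a := s - 1 / 2) (b := s + 1 / 2) (splineDeriv (p + 1))
    (((p + 1 : ℕ) : ℝ) / 2 + 1 - c)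
  have h2 := integral_comp_add_left (a := s - 1 / 2) (b := s + 1 / 2) (splineDeriv (p + 1))
    (((p + 1 : ℕ) : ℝ) / 2 + 1 - c)
  unfold splineSkew
  rw [intervalIntegral.integral_sub (Continuous.intervalIntegrable (by fun_prop) _ _)
    (Continuous.intervalIntegrable (by fun_prop) _ _), h1, h2, splineDeriv_succ, splineDeriv_succ,
    mul_sub]
  push_cast
  congr 3 <;> ring

lemma integral_neg_self_of_odd {f : ℝ → ℝ} (hf : ∀ x, f (-x) = -f x) (a : ℝ) :
    ∫ x in (-a)..a, f x = 0 := by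
  have h := integral_comp_neg (a := -a) (b := a) f
  simp only [hf, intervalIntegral.integral_neg, neg_neg] at h
  linarith

/-- The part of the window symmetric about `0` cancels. For `0 ≤ s ≤ 1 / 2` what remains lies in the
nonnegative half-line. -/
lemma integral_window_of_odd {f : ℝ → ℝ} (hc : Continuous f) (hf : ∀ x, f (-x) = -f x) {s : ℝ} :
    ∫ u in (s - 1 / 2)..(s + 1 / 2), f u = ∫ u in (1 / 2 - s)..(1 / 2 + s), f u := by
  have h := integral_neg_self_of_odd hf (1 / 2 - s)
  have h1 := integral_add_adjacent_intervals (hc.intervalIntegrable (-(1 / 2 - s)) (1 / 2 - s))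
    (hc.intervalIntegrable (1 / 2 - s) (1 / 2 + s)) (μ := volume)
  rw [h, zero_add] at h1
  rw [h1]
  congr 1 <;> ring

lemma splineDeriv_two (x : ℝ) : splineDeriv 2 x = max x 0 ^ 2 - 4 * max (x - 1) 0 ^ 2
    + 6 * max (x - 2) 0 ^ 2 - 4 * max (x - 3) 0 ^ 2 + max (x - 4) 0 ^ 2 := by
  simp [splineDeriv, Finset.sum_range_succ, Nat.choose]
  ring

lemma splineDeriv_two_nonneg {x : ℝ} (hx : x ≤ 2) : 0 ≤ splineDeriv 2 x := by
  rw [splineDeriv_two, max_eq_right (show x - 2 ≤ 0 by linarith),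
    max_eq_right (show x - 3 ≤ 0 by linarith), max_eq_right (show x - 4 ≤ 0 by linarith)]
  rcases le_total x 1 with h1 | h1
  · rw [max_eq_right (show x - 1 ≤ 0 by linarith)]
    nlinarith [sq_nonneg (max x 0)]
  · rw [max_eq_left (show 0 ≤ x - 1 by linarith), max_eq_left (show 0 ≤ x by linarith)]
    nlinarith

lemma splineDeriv_two_nonpos {x : ℝ} (hx : 2 ≤ x) : splineDeriv 2 x ≤ 0 := by
  rw [splineDeriv_two, max_eq_left (show 0 ≤ x - 2 by linarith),
    max_eq_left (show 0 ≤ x - 1 by linarith), max_eq_left (show 0 ≤ x by linarith)]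
  rcases le_total x 3 with h1 | h1
  · rw [max_eq_right (show x - 3 ≤ 0 by linarith), max_eq_right (show x - 4 ≤ 0 by linarith)]
    nlinarith
  · rw [max_eq_left (show 0 ≤ x - 3 by linarith)]
    rcases le_total x 4 with h2 | h2
    · rw [max_eq_right (show x - 4 ≤ 0 by linarith)]
      nlinarith [sq_nonneg (x - 4)]
    · rw [max_eq_left (show 0 ≤ x - 4 by linarith)]
      nlinarith

lemma splineDeriv_two_eq {y : ℝ} (h0 : 0 ≤ y) (h1 : y ≤ 1) :
    splineDeriv 2 (2 - y) = 4 * y - 3 * y ^ 2 := by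
  rw [splineDeriv_two, max_eq_right (show 2 - y - 2 ≤ 0 by linarith),
    max_eq_right (show 2 - y - 3 ≤ 0 by linarith), max_eq_right (show 2 - y - 4 ≤ 0 by linarith),
    max_eq_left (show 0 ≤ 2 - y - 1 by linarith), max_eq_left (show 0 ≤ 2 - y by linarith)]
  ring

lemma le_splineDeriv_two {y : ℝ} (h0 : 0 ≤ y) :
    4 * y - 3 * y ^ 2 ≤ splineDeriv 2 (2 - y) := by
  rcases le_total y 1 with h1 | h1
  · exact (splineDeriv_two_eq h0 h1).ge
  rcases le_total y 2 with h2 | h2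
  · rw [splineDeriv_two, max_eq_right (show 2 - y - 2 ≤ 0 by linarith),
      max_eq_right (show 2 - y - 3 ≤ 0 by linarith), max_eq_right (show 2 - y - 4 ≤ 0 by linarith),
      max_eq_right (show 2 - y - 1 ≤ 0 by linarith), max_eq_left (show 0 ≤ 2 - y by linarith)]
    nlinarith [sq_nonneg (y - 1)]
  · refine le_trans ?_ (splineDeriv_two_nonneg (by linarith))
    nlinarith

/-- For `s ≤ c` the quadratic piece `4 y - 3 y ^ 2` at `y = c ± s` gives the lower bound `4 s (2 - 3
c)`, whence the constant `2 / 3`. For `s ≥ c` the two arguments lie on opposite sides of the center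
`2`, where the signs are known. -/
lemma splineSkew_two {c : ℝ} (h1 : 1 / 2 ≤ c) (h2 : c < 2 / 3) :
    (∀ s, 0 ≤ s → 0 ≤ splineSkew c 2 s) ∧ 0 < splineSkew c 2 (1 / 2) := by
  have key (s : ℝ) (h0 : 0 ≤ s) (hs : s ≤ c) : 4 * s * (2 - 3 * c) ≤ splineSkew c 2 s := by
    have h3 := le_splineDeriv_two (show 0 ≤ c + s by linarith)
    have h4 := splineDeriv_two_eq (show 0 ≤ c - s by linarith) (by linarith)
    have h5 : splineSkew c 2 s = splineDeriv 2 (2 - (c + s)) - splineDeriv 2 (2 - (c - s)) := by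
      rw [splineSkew]
      congr 2 <;> push_cast <;> ring
    rw [h5, h4]
    linarith
  refine ⟨fun s hs => ?_, ?_⟩
  · rcases le_total s c with h | h
    · refine le_trans ?_ (key s hs h)
      exact mul_nonneg (by linarith) (by linarith)
    · refine sub_nonneg.mpr ((splineDeriv_two_nonpos ?_).trans (splineDeriv_two_nonneg ?_))
      · push_cast
        linarith
      · push_cast
        linarith
  · refine lt_of_lt_of_le ?_ (key (1 / 2) (by norm_num) h1)
    linarith

/-- Averaging over unit windows preserves oddness and nonnegativity on `s ≥ 0`. Positivity at `1 /
2` also persists, since the window there is `[0, 1]` and contains `1 / 2`. -/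
lemma splineSkew_nonneg {c : ℝ} (h1 : 1 / 2 ≤ c) (h2 : c < 2 / 3) (p : ℕ) :
    (∀ s, 0 ≤ s → 0 ≤ splineSkew c (p + 2) s) ∧ 0 < splineSkew c (p + 2) (1 / 2) := by
  induction p with
  | zero => exact splineSkew_two h1 h2
  | succ p ih =>
    have hc := continuous_splineSkew c (p + 2)
    have hodd := splineSkew_neg c (p + 2)
    have hp : (0 : ℝ) < ((p + 1 : ℕ) : ℝ) + 2 := by positivity
    refine ⟨fun s hs => ?_, ?_⟩
    · rw [show p + 1 + 2 = (p + 1) + 2 from rfl, splineSkew_succ]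
      refine mul_nonneg hp.le ?_
      rcases le_total s (1 / 2) with h | h
      · rw [integral_window_of_odd hc hodd]
        exact integral_nonneg (by linarith) fun u hu => ih.1 u (by linarith [hu.1])
      · exact integral_nonneg (by linarith) fun u hu => ih.1 u (by linarith [hu.1])
    · rw [show p + 1 + 2 = (p + 1) + 2 from rfl, splineSkew_succ]
      refine mul_pos hp (integral_pos (by norm_num) hc.continuousOn
        (fun u hu => ih.1 u (by linarith [hu.1])) ⟨1 / 2, by norm_num, ih.2⟩)

/-- The leading coefficient of `P m q` is negative. -/
theorem leadingSum_neg {m : ℕ} (hm : 2 ≤ m) :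
    ∑ k ∈ Finset.range (m + 1), (-1 : ℝ) ^ k * ((2 * m + 2).choose k : ℝ) *
      (2 * m * (m + 1) - k * (2 * m + 1)) ^ (2 * m - 1) < 0 := by
  have hm' : (2 : ℝ) ≤ m := by exact_mod_cast hm
  have hpos : (0 : ℝ) < 2 * m + 1 := by positivity
  set c : ℝ := (m + 1) / (2 * m + 1) with hc
  have hcm : c * (2 * m + 1) = m + 1 := div_mul_cancel₀ _ hpos.ne'
  have h1 : 1 / 2 ≤ c := by
    rw [hc, div_le_div_iff₀ two_pos hpos]
    linarith
  -- This is where `2 ≤ m` matters: for `m = 1` the ratio is exactly `2 / 3`.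
  have h2 : c < 2 / 3 := by
    rw [hc, div_lt_div_iff₀ hpos three_pos]
    linarith
  obtain ⟨p, hp⟩ : ∃ p, 2 * m - 1 = p + 2 := ⟨2 * m - 3, by omega⟩
  have hpm : 2 * m = p + 3 := by omega
  have hpm' : (2 : ℝ) * m = p + 3 := by exact_mod_cast hpm
  have h3 := (splineSkew_nonneg h1 h2 p).2
  set x : ℝ := m + 1 - c with hx
  have h4 : splineSkew c (p + 2) (1 / 2) = splineDeriv (p + 2) (x - 1) - splineDeriv (p + 2) x := by
    rw [splineSkew]
    congr 2
    · push_cast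
      linarith
    · push_cast
      linarith
  have h5 : splineDeriv (p + 2) x - splineDeriv (p + 2) (x - 1)
      = ∑ k ∈ Finset.range (p + 6), (-1) ^ k * ((p + 5).choose k : ℝ) *
        max (x - k) 0 ^ (p + 2) := by
    rw [alternating_sum_choose_succ (p + 4) fun k => max (x - k) 0 ^ (p + 2), splineDeriv,
      splineDeriv, ← Finset.sum_sub_distrib]
    refine Finset.sum_congr rfl fun k _ => ?_
    rw [show x - 1 - k = x - ((k + 1 : ℕ) : ℝ) by push_cast; ring]
    ring
  -- Since `2 m (m + 1) = (2 m + 1) x` with `m < x < m + 1`, the truncated powers vanish exactly for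
  -- `k > m`, which matches the range of the sum.
  have h6 : ∑ k ∈ Finset.range (m + 1), (-1 : ℝ) ^ k * ((2 * m + 2).choose k : ℝ) *
      (2 * m * (m + 1) - k * (2 * m + 1)) ^ (2 * m - 1)
      = (2 * m + 1) ^ (p + 2) * (splineDeriv (p + 2) x - splineDeriv (p + 2) (x - 1)) := by
    rw [h5, Finset.mul_sum, hp, show 2 * m + 2 = p + 5 by omega]
    rw [← Finset.sum_subset (s₁ := Finset.range (m + 1)) (s₂ := Finset.range (p + 6))]
    · refine Finset.sum_congr rfl fun k hk => ?_
      have hk' : (k : ℝ) ≤ m := by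
        exact_mod_cast Nat.lt_succ_iff.mp (Finset.mem_range.mp hk)
      rw [max_eq_left (by linarith), mul_left_comm, ← mul_pow]
      congr 2
      rw [hx]
      linear_combination hcm
    · exact Finset.range_subset_range.mpr (by omega)
    · intro k _ hk
      have hk' : ((m + 1 : ℕ) : ℝ) ≤ k := by
        exact_mod_cast (by simpa using hk : m + 1 ≤ k)
      push_cast at hk'
      rw [max_eq_right (by linarith), zero_pow (by omega), mul_zero, mul_zero]
  rw [h6]
  exact mul_neg_of_pos_of_neg (by positivity) (by linarith)

end Spline

/-! ### Large `d`. -/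

section Asymptotics

open Filter Topology

lemma choose_eq_prod_div (x : ℝ) (r : ℕ) :
    Ring.choose x r = (∏ i ∈ Finset.range r, (x - i)) / r.factorial := by
  rw [Ring.choose_eq_smul, ← Polynomial.aeval_eq_smeval, Polynomial.aeval_def,
    Polynomial.eval₂_eq_eval_map, descPochhammer_map, descPochhammer_eval_eq_prod_range, smul_eq_mul,
    div_eq_inv_mul]

lemma tendsto_choose_div_pow (A B : ℝ) (r : ℕ) :
    Tendsto (fun t : ℕ => Ring.choose (A + t * B) r / (t : ℝ) ^ r) atTop
      (𝓝 (B ^ r / r.factorial)) := by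
  have h1 (i : ℕ) : Tendsto (fun t : ℕ => (A - i) / (t : ℝ) + B) atTop (𝓝 B) := by
    simpa using (tendsto_const_div_atTop_nhds_zero_nat (A - i)).add_const B
  have h2 := (tendsto_finsetProd (Finset.range r) fun i _ => h1 i).div_const (r.factorial : ℝ)
  rw [Finset.prod_const, Finset.card_range] at h2
  refine h2.congr' ?_
  filter_upwards [eventually_gt_atTop 0] with t ht
  have ht' : (t : ℝ) ≠ 0 := by exact_mod_cast ht.ne'
  have h3 (i : ℕ) : (A - i) / (t : ℝ) + B = (A + t * B - i) / t := by
    field_simp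
    ring
  rw [choose_eq_prod_div, Finset.prod_congr rfl fun i _ => h3 i, Finset.prod_div_distrib,
    Finset.prod_const, Finset.card_range, div_right_comm]

/-- `P m q t / t ^ (2 m - 1)` tends to the sum of `leadingSum_neg` divided by `(2 m - 1)!`; `q` only
affects lower order terms. -/
lemma eventually_P_nonpos {m : ℕ} (hm : 2 ≤ m) (q : ℕ) :
    ∃ T : ℕ, ∀ t : ℕ, T ≤ t → P m q t ≤ 0 := by
  have h1 := tendsto_finsetSum (Finset.range (m + 1)) fun k _ =>
    (tendsto_choose_div_pow
      ((m : ℝ) - 1 + ((m * q / (2 * m + 1) : ℕ) : ℝ) + (q + 1) * (m - k))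
      (2 * m * (m + 1) - k * (2 * m + 1)) (2 * m - 1)).const_mul
        ((-1) ^ k * ((2 * m + 2).choose k : ℝ))
  have h2 : ∑ k ∈ Finset.range (m + 1), (-1 : ℝ) ^ k * ((2 * m + 2).choose k : ℝ) *
      ((2 * m * (m + 1) - k * (2 * m + 1)) ^ (2 * m - 1) / (2 * m - 1).factorial) < 0 := by
    simp only [← mul_div_assoc]
    rw [← Finset.sum_div]
    exact div_neg_of_neg_of_pos (leadingSum_neg hm) (by positivity)
  obtain ⟨T, hT⟩ := eventually_atTop.mp
    ((h1.eventually (gt_mem_nhds h2)).and (eventually_gt_atTop 0))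
  refine ⟨T, fun t ht => ?_⟩
  obtain ⟨h3, h4⟩ := hT t ht
  have h5 : (0 : ℝ) < (t : ℝ) ^ (2 * m - 1) := by positivity
  simp only [← mul_div_assoc] at h3
  rw [← Finset.sum_div] at h3
  exact (neg_of_div_neg_left h3 h5.le).le

lemma exists_eq_of_dvd {m q d : ℕ} (hd : q < d) (h : (2 * m + 1 : ℤ) ∣ (d : ℤ) - 1 - q) :
    ∃ t, d = (2 * m + 1) * t + q + 1 := by
  obtain ⟨t, ht⟩ := h
  have h0 : 0 ≤ t := by
    by_contra h
    push Not at h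
    have : (2 * m + 1 : ℤ) * t < 0 := mul_neg_of_pos_of_neg (by positivity) h
    omega
  lift t to ℕ using h0
  refine ⟨t, ?_⟩
  zify
  linarith

/-- The conjecture holds for all sufficiently large `d`. -/
theorem exists_forall_failureConjecture {m : ℕ} (hm : 2 ≤ m) :
    ∃ D : ℕ, ∀ d : ℕ, D ≤ d → FailureConjecture.{u} (2 * m) d := by
  choose T hT using eventually_P_nonpos hm
  -- The bound makes the quotient `t` of `d - 1` by `2 * m + 1` exceed the threshold of every
  -- residue `q`.
  refine ⟨(2 * m + 1) * ((Finset.range (2 * m + 1)).sup T + 1) + 2, fun d hd => ?_⟩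
  have hq : (d - 1) % (2 * m + 1) < 2 * m + 1 := Nat.mod_lt _ (by omega)
  have hdiv := Nat.div_add_mod (d - 1) (2 * m + 1)
  have hTq : T ((d - 1) % (2 * m + 1)) ≤ (Finset.range (2 * m + 1)).sup T :=
    Finset.le_sup (Finset.mem_range.mpr hq)
  refine failureConjecture_of_P_nonpos (t := (d - 1) / (2 * m + 1)) hm (Nat.lt_succ_iff.mp hq)
    (by omega) (by omega) (hT _ _ (hTq.trans ?_))
  rw [Nat.le_div_iff_mul_le (by omega)]
  nlinarith [Nat.sub_add_cancel (show 1 ≤ d by omega)]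

end Asymptotics

end UniformPowers

end

theorem proposition6p2 (m : ℕ) (hm : 2 ≤ m) :
    -- part (a)
    (∀ q : ℕ, q ≤ 2 * m →
      (¬ ∃ c : ℝ, 0 < c ∧ ∀ t : ℝ, UniformPowers.P m q t = c) →
      ∃ D : ℕ, ∀ d : ℕ, D ≤ d → (2 * m + 1 : ℤ) ∣ (d : ℤ) - 1 - q →
        UniformPowers.FailureConjecture.{u} (2 * m) d) ∧
    -- part (b)
    (∀ q : ℕ, 1 ≤ q → q ≤ 2 * m →
      (∀ t : ℕ, UniformPowers.P m q (t : ℝ) ≤ 0) →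
      ∀ d : ℕ, (2 * m : ℤ) ^ 2 - 2 * m + 2 ≤ d → (2 * m + 1 : ℤ) ∣ (d : ℤ) - 1 - q →
        UniformPowers.FailureConjecture.{u} (2 * m) d) ∧
    -- part (c)
    ((∀ t : ℕ, 1 ≤ t → UniformPowers.P m 0 (t : ℝ) ≤ 0) →
      ∀ d : ℕ, (2 * m + 1 : ℤ) ∣ (d : ℤ) - 1 →
        UniformPowers.FailureConjecture.{u} (2 * m) d) ∧
    -- part (d)
    (∑ k ∈ Finset.range (m + 1), (-1 : ℤ) ^ k * ((2 * m + 2).choose k : ℤ) *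
        (2 * m * (m + 1) - k * (2 * m + 1)) ^ (2 * m - 1) ≠ 0 →
      ∃ D : ℕ, ∀ d : ℕ, D ≤ d → UniformPowers.FailureConjecture.{u} (2 * m) d) ∧
    -- part (e)
    (5 ≤ m →
      (UniformPowers.eulerian (2 * m - 1) (m - 1) : ℤ)
        - 2 * UniformPowers.eulerian (2 * m - 1) (m - 2)
        + UniformPowers.eulerian (2 * m - 1) (m - 3) < 0 →
      ∃ D : ℕ, ∀ d : ℕ, D ≤ d → UniformPowers.FailureConjecture.{u} (2 * m) d) := by
  obtain ⟨D, hD⟩ := UniformPowers.exists_forall_failureConjecture.{u} hm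
  refine ⟨fun q _ _ => ⟨D, fun d hd _ => hD d hd⟩, fun q hq1 hq hP d hd hdvd => ?_,
    fun hP d hdvd => ?_, fun _ => ⟨D, hD⟩, fun _ _ => ⟨D, hD⟩⟩
  -- The bound `n ^ 2 - n + 2` exceeds `2 * m ≥ q`, so the quotient `t` is not negative.
  · have hqd : q < d := by
      have h1 : (q : ℤ) ≤ 2 * m := by exact_mod_cast hq
      have h2 : (2 : ℤ) ≤ m := by exact_mod_cast hm
      have h3 : (q : ℤ) < d := by nlinarith
      exact_mod_cast h3
    obtain ⟨t, ht⟩ := UniformPowers.exists_eq_of_dvd hqd hdvd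
    exact UniformPowers.failureConjecture_of_P_nonpos hm hq ht (by omega) (hP t)
  · have hd0 : 0 < d := by
      rcases Nat.eq_zero_or_pos d with rfl | h
      · have h1 := Int.le_of_dvd one_pos (dvd_neg.mp (by simpa using hdvd))
        omega
      · exact h
    obtain ⟨t, ht⟩ := UniformPowers.exists_eq_of_dvd (q := 0) hd0 (by simpa using hdvd)
    -- `t = 0` means `d = 1`, where the assertion is that the weak Lefschetz property holds.
    rcases Nat.eq_zero_or_pos t with rfl | h
    · obtain rfl : d = 1 := by simpa using ht
      exact UniformPowers.failureConjecture_one _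
    · exact UniformPowers.failureConjecture_of_P_nonpos hm (Nat.zero_le _) ht
        (by have : 1 ≤ (2 * m + 1) * t := Nat.mul_pos (by omega) h
            omega) (hP t h)
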